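/- Let $N\ge 0$, let $k_1,\dots,k_N$ be nonzero real numbers with $k_i\neq\pm k_j$ for $i\ne j$, and let $\eta_{10},\dots,\eta_{N0}\in\mathbb R$. For $(x_1,x_{-1})\in\mathbb R^2$ put $$\tau=\sum_{\mu\in\{0,1\}^N}\exp\Big[\sum_{i=1}^N\mu_i\eta_i+\sum_{1\le i<j\le N}\mu_i\mu_j\ln b_{ij}\Big],\qquad \eta_i=k_ix_1+\frac{3}{k_i}x_{-1}+\eta_{i0},$$ $$b_{ij}=\frac{(k_i-k_j)^2(k_i^2-k_ik_j+k_j^2)}{(k_i+k_j)^2(k_i^2+k_ik_j+k_j^2)},$$ $f=\tau^2$, $u=-(\ln f)_{x_1x_1}=-2(\ln\tau)_{x_1x_1}$, and consider the hodograph transformation $\Phi:(x_1,x_{-1})\mapsto(x,t)$, $$x=x_{-1}-(\ln f)_{x_1},\qquad t=x_1 .$$ Then $u$ is, through $\Phi$, a (possibly multivalued) solution of the reduced Ostrovsky equation $$\partial_x(\partial_t+u\,\partial_x)u-3u=0 .$$ Precisely, let $R\subset\mathbb R^2$ be the set of points at which $\partial x/\partial x_{-1}\ne0$. Then $R$ is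 dense; every point of $R$ has an open neighbourhood $V\subseteq R$ on which $\Phi$ is injective; and whenever $V\subseteq R$ is open and $\Phi$ is injective on $V$, the set $\Phi(V)$ is open, and the function $U$ on $\Phi(V)$ determined by $U(\Phi(x_1,x_{-1}))=u(x_1,x_{-1})$ is $C^\infty$ and satisfies $\partial_x(\partial_tU+U\,\partial_xU)-3U=0$ on $\Phi(V)$. Moreover, if all $k_i>0$, then for all $(x_1,x_{-1})$ the function $u(\cdot,x_{-1})$ is integrable on $(-\infty,x_1]$ and $$x=x_{-1}+\int_{-\infty}^{x_1}u(x_1',x_{-1})\,dx_1' .$$ -/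

import Mathlib

open scoped ContDiff

noncomputable section

namespace ReducedOstrovsky

/-- Partial derivative of `F` with respect to the first variable. -/
def pderivFst (F : ℝ × ℝ → ℝ) (p : ℝ × ℝ) : ℝ :=
  deriv (fun s => F (s, p.2)) p.1

/-- Partial derivative of `F` with respect to the second variable. -/
def pderivSnd (F : ℝ × ℝ → ℝ) (p : ℝ × ℝ) : ℝ :=
  deriv (fun s => F (p.1, s)) p.2

/-- `U`, a function of `(x, t)`, is a smooth solution on the open set `W` of the reduced Ostrovsky
equation `∂ₓ (∂ₜ + U ∂ₓ) U - 3 U = 0`. -/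
structure IsSolutionOn (U : ℝ × ℝ → ℝ) (W : Set (ℝ × ℝ)) : Prop where
  isOpen : IsOpen W
  contDiffOn : ContDiffOn ℝ ∞ U W
  equation : ∀ q ∈ W,
    pderivFst (fun r => pderivSnd U r + U r * pderivFst U r) q - 3 * U q = 0

variable {N : ℕ}

/-- The phase `η_i = k_i x₁ + (3 / k_i) x₋₁ + η_{i0}`, where `p = (x₁, x₋₁)`. -/
def phase (k η₀ : Fin N → ℝ) (i : Fin N) (p : ℝ × ℝ) : ℝ :=
  k i * p.1 + 3 / k i * p.2 + η₀ i

/-- The interaction coefficient `b_{ij}`. -/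
def coeffB (k : Fin N → ℝ) (i j : Fin N) : ℝ :=
  ((k i - k j) ^ 2 * (k i ^ 2 - k i * k j + k j ^ 2)) /
    ((k i + k j) ^ 2 * (k i ^ 2 + k i * k j + k j ^ 2))

/-- The `N`-soliton `τ`-function in Hirota form, a function of `p = (x₁, x₋₁)`. -/
def tau (k η₀ : Fin N → ℝ) (p : ℝ × ℝ) : ℝ :=
  ∑ μ : Fin N → Fin 2,
    Real.exp (∑ i, ((μ i : ℕ) : ℝ) * phase k η₀ i p +
      ∑ i, ∑ j ∈ Finset.Ioi i,
        ((μ i : ℕ) : ℝ) * ((μ j : ℕ) : ℝ) * Real.log (coeffB k i j))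

/-- `u = -2 (ln τ)_{x₁ x₁}`, a function of `p = (x₁, x₋₁)`. -/
def solitonU (k η₀ : Fin N → ℝ) (p : ℝ × ℝ) : ℝ :=
  -2 * pderivFst (pderivFst (fun q => Real.log (tau k η₀ q))) p

/-- The `x`-component `x = x₋₁ - (ln f)_{x₁}`, `f = τ²`, of the hodograph transformation. -/
def hodographX (k η₀ : Fin N → ℝ) (p : ℝ × ℝ) : ℝ :=
  p.2 - pderivFst (fun q => Real.log (tau k η₀ q ^ 2)) p

/-- The hodograph transformation `(x₁, x₋₁) ↦ (x, t)`, with `t = x₁`. -/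
def hodograph (k η₀ : Fin N → ℝ) (p : ℝ × ℝ) : ℝ × ℝ :=
  (hodographX k η₀ p, p.1)

/-- The points `(x₁, x₋₁)` at which `∂x/∂x₋₁ ≠ 0`. This derivative is, up to sign, the Jacobian
determinant of the hodograph transformation. -/
def regularSet (k η₀ : Fin N → ℝ) : Set (ℝ × ℝ) :=
  {p | pderivSnd (hodographX k η₀) p ≠ 0}

end ReducedOstrovsky

end

open scoped ContDiff


/-! ### Products over pairs and sums over sign changes. -/

namespace ReducedOstrovsky

open Polynomial Finset

/-! Write s = x₁, y = x₋₁ and J = ∂x/∂y. Since x_s = u, the operator ∂ₜ + U∂ₓ becomes ∂_s, and J∂ₓ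
becomes ∂_y. The equation therefore pulls back to (u_s)_y = 3uJ wherever J ≠ 0, and the inverse
function theorem carries this back to (x, t) (`isSolutionOn_of_hodograph`).

In terms of τ this is Hirota's bilinear equation (D_s³D_y - 3D_s²)τ·τ = 0. Inserting the exponential
sum gives a sum over pairs of multi-indices. Exchanging entries between the two members of a pair
changes signs of the wave number differences, and summing over these exchanges
(`sum_bilinearTerm_signSwap`) leaves the algebraic identity `hirota_condition`: over all signs of
the kᵢ, the sum of dispersion relation times the product of pair quartics is zero.

That identity is proved by induction on the number of solitons. As a function of one wave number,
with n others fixed, the sum times that wave number is an odd polynomial F of degree at most 4n + 2.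
By induction F is divisible by X³ and by every (X² - kⱼ²)². These factors are coprime of total
degree 4n + 3, so F = 0.

Density of the regular set follows from analyticity along the lines s = const: if J vanished on a
whole such line, x would be constant there, but x - y is bounded on it. The integral formula holds
because (ln τ)_s tends to 0 as s → -∞ when all kᵢ > 0. -/

/-- The product of `f i j` over all pairs `i < j` in `A`. -/
def pairProd {ι R : Type*} [LinearOrder ι] [CommMonoid R] (A : Finset ι) (f : ι → ι → R) : R :=
  ∏ i ∈ A, ∏ j ∈ A, if i < j then f i j else 1

theorem pairProd_insert {ι R : Type*} [LinearOrder ι] [CommMonoid R] {A : Finset ι} {a : ι}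
    {f : ι → ι → R} (hf : ∀ i j, f i j = f j i) (ha : a ∉ A) :
    pairProd (insert a A) f = (∏ j ∈ A, f a j) * pairProd A f := by
  unfold pairProd
  rw [prod_insert ha, prod_insert ha]
  simp_rw [prod_insert ha]
  rw [prod_mul_distrib, if_neg (lt_irrefl a), one_mul, ← mul_assoc, ← prod_mul_distrib]
  congr 1
  refine prod_congr rfl fun j hj => ?_
  have hne : a ≠ j := fun h => ha (h ▸ hj)
  rcases lt_or_gt_of_ne hne with h | h
  · simp [h, h.not_gt]
  · simp [h, h.not_gt, hf j a]

theorem pairProd_congr {ι R : Type*} [LinearOrder ι] [CommMonoid R] {A : Finset ι}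
    {f g : ι → ι → R} (h : ∀ i ∈ A, ∀ j ∈ A, f i j = g i j) : pairProd A f = pairProd A g :=
  prod_congr rfl fun i hi => prod_congr rfl fun j hj => by rw [h i hi j hj]

section SignSum

variable {ι : Type*} [Fintype ι] [DecidableEq ι] {R : Type*} [AddCommGroup R]

/-- The sum of `f κ` over all vectors `κ` obtained from `k` by changing the signs of entries. -/
def signSum (k : ι → ℝ) (f : (ι → ℝ) → R) : R :=
  ∑ ε : ι → ℤˣ, f fun i => ((ε i : ℤ) : ℝ) * k i

theorem signSum_congr {k : ι → ℝ} {f g : (ι → ℝ) → R}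
    (h : ∀ κ : ι → ℝ, (∀ i, κ i = k i ∨ κ i = -k i) → f κ = g κ) : signSum k f = signSum k g := by
  refine sum_congr rfl fun ε _ => h _ fun i => ?_
  rcases Int.units_eq_one_or (ε i) with h | h <;> simp [h]

theorem signSum_neg (k : ι → ℝ) (f : (ι → ℝ) → R) :
    signSum k (fun κ => f (-κ)) = signSum k f := by
  unfold signSum
  exact Fintype.sum_equiv (Equiv.neg _) _ _ fun ε => congrArg f (funext fun i => by simp)

theorem signSum_add (k : ι → ℝ) (f g : (ι → ℝ) → R) :
    signSum k (fun κ => f κ + g κ) = signSum k f + signSum k g := sum_add_distrib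

theorem signSum_map {R' : Type*} [AddCommGroup R'] (k : ι → ℝ) (f : (ι → ℝ) → R) (φ : R →+ R') :
    φ (signSum k f) = signSum k (fun κ => φ (f κ)) := map_sum φ _ _

theorem signSum_const_mul (k : ι → ℝ) (f : (ι → ℝ) → ℝ) (c : ℝ) :
    signSum k (fun κ => c * f κ) = c * signSum k f := (mul_sum _ _ _).symm

theorem signSum_eq_zero_of_odd {k : ι → ℝ} {f : (ι → ℝ) → ℝ} (h : ∀ κ, f (-κ) = -f κ) :
    signSum k f = 0 := by
  have h1 := signSum_neg k f
  have h2 : signSum k (fun κ => f (-κ)) = - signSum k f := by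
    simp_rw [h]
    exact sum_neg_distrib _
  linarith

/-- Multiplying all other signs by the sign at `a` is a bijection of sign vectors; the common sign
it extracts is absorbed by evenness. -/
theorem signSum_update_of_even (k : ι → ℝ) (a : ι) {f : (ι → ℝ) → R} (h : ∀ κ, f (-κ) = f κ) :
    signSum k f = signSum k (fun κ => f (Function.update κ a (k a))) := by
  unfold signSum
  let e : (ι → ℤˣ) → (ι → ℤˣ) := fun ε i => if i = a then ε a else ε a * ε i
  have he : Function.Involutive e := by
    intro ε
    ext i
    by_cases hi : i = a
    · simp [e, hi]
    · rcases Int.units_eq_one_or (ε a) with h | h <;> simp [e, hi, h]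
  refine (Fintype.sum_equiv he.toPerm _ _ fun ε => ?_).symm
  rcases Int.units_eq_one_or (ε a) with h1 | h1
  · refine congrArg f (funext fun i => ?_)
    by_cases hi : i = a
    · subst hi
      simp [e, h1]
    · simp [e, h1, hi]
  · rw [← h]
    refine congrArg f (funext fun i => ?_)
    by_cases hi : i = a
    · subst hi
      simp [e, h1]
    · simp [e, h1, hi]

/-- Each sign vector is paired with the one differing only at `a`; every pair is then counted twice
on both sides. -/
theorem two_signSum (k : ι → ℝ) (a : ι) (f : (ι → ℝ) → R) :
    signSum k f + signSum k f = signSum k (fun κ => f (Function.update κ a (k a))) +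
      signSum k (fun κ => f (Function.update κ a (-k a))) := by
  unfold signSum
  let e : (ι → ℤˣ) → (ι → ℤˣ) := fun ε i => if i = a then -ε a else ε i
  have he : Function.Involutive e := by
    intro ε
    ext i
    by_cases hi : i = a <;> simp [e, hi]
  have h1 : ∑ ε : ι → ℤˣ, f (fun i => ((ε i : ℤ) : ℝ) * k i) =
      ∑ ε : ι → ℤˣ, f (fun i => ((e ε i : ℤ) : ℝ) * k i) :=
    (Fintype.sum_equiv he.toPerm _ _ fun ε => rfl).symm
  nth_rewrite 2 [h1]
  rw [← sum_add_distrib, ← sum_add_distrib]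
  refine sum_congr rfl fun ε _ => ?_
  beta_reduce
  have h2 : ∀ y : ℝ, ∀ δ : ι → ℤˣ, (∀ i, i ≠ a → δ i = ε i) → ((δ a : ℤ) : ℝ) * k a = y →
      (fun i => ((δ i : ℤ) : ℝ) * k i) =
        Function.update (fun i => ((ε i : ℤ) : ℝ) * k i) a y := by
    intro y δ hδ hy
    ext i
    by_cases hi : i = a
    · subst hi
      simp [hy]
    · simp [hi, hδ i hi]
  rcases Int.units_eq_one_or (ε a) with h | h
  · rw [← h2 (k a) ε (fun _ _ => rfl) (by simp [h]),
      ← h2 (-k a) (e ε) (fun i hi => by simp [e, hi]) (by simp [e, h])]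
  · rw [← h2 (-k a) ε (fun _ _ => rfl) (by simp [h]),
      ← h2 (k a) (e ε) (fun i hi => by simp [e, hi]) (by simp [e, h]), add_comm]

end SignSum

/-! ### The quartic and dispersion polynomials and their extreme coefficients. -/

/-- The quartic form governing the interaction of two solitons. -/
noncomputable def quartic (x y : ℝ) : ℝ := (x - y) ^ 2 * (x ^ 2 - x * y + y ^ 2)

theorem quartic_comm (x y : ℝ) : quartic x y = quartic y x := by unfold quartic; ring

theorem quartic_neg_neg (x y : ℝ) : quartic (-x) (-y) = quartic x y := by unfold quartic; ring

/-- `quartic x y` as a polynomial in `x`. -/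
noncomputable def quarticPoly (y : ℝ) : ℝ[X] := (X - C y) ^ 2 * (X ^ 2 - C y * X + C (y ^ 2))

theorem eval_quarticPoly (x y : ℝ) : (quarticPoly y).eval x = quartic x y := by
  simp only [quarticPoly, quartic, eval_mul, eval_pow, eval_sub, eval_add, eval_X, eval_C]; ring

theorem quarticPoly_neg (y : ℝ) : quarticPoly (-y) = (quarticPoly y).comp (-X) := by
  simp only [quarticPoly, mul_comp, pow_comp, sub_comp, add_comp, X_comp, C_comp, map_neg, map_pow]
  ring

theorem quarticPoly_eq (y : ℝ) : quarticPoly y =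
    X ^ 4 + C (-3 * y) * X ^ 3 + C (4 * y ^ 2) * X ^ 2 + C (-3 * y ^ 3) * X + C (y ^ 4) := by
  simp only [quarticPoly, map_mul, map_neg, map_pow, map_ofNat]; ring

theorem natDegree_quarticPoly_le (y : ℝ) : (quarticPoly y).natDegree ≤ 4 := by
  rw [quarticPoly_eq]; compute_degree

theorem coeff_quarticPoly (y : ℝ) : (quarticPoly y).coeff 0 = y ^ 4 ∧
    (quarticPoly y).coeff 1 = -3 * y ^ 3 ∧ (quarticPoly y).coeff 3 = -3 * y ∧
    (quarticPoly y).coeff 4 = 1 := by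
  rw [quarticPoly_eq]
  simp only [coeff_add, coeff_C_mul, coeff_X_pow, coeff_X, coeff_C]
  norm_num

/-- The dispersion polynomial of one soliton, as a polynomial in its wave number, in the background
of solitons whose signed wave numbers have sum `S` and inverses with sum `T`. -/
noncomputable def dispersionPoly (S T : ℝ) : ℝ[X] := (X + C S) ^ 3 * (1 + C T * X) - X * (X + C S) ^ 2

theorem dispersionPoly_eq (S T : ℝ) : dispersionPoly S T =
    C T * X ^ 4 + C (3 * S * T) * X ^ 3 + C (S + 3 * S ^ 2 * T) * X ^ 2 +
      C (2 * S ^ 2 + S ^ 3 * T) * X + C (S ^ 3) := by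
  simp only [dispersionPoly, map_add, map_mul, map_pow, map_ofNat]; ring

theorem natDegree_dispersionPoly_le (S T : ℝ) : (dispersionPoly S T).natDegree ≤ 4 := by
  rw [dispersionPoly_eq]; compute_degree

theorem coeff_dispersionPoly (S T : ℝ) : (dispersionPoly S T).coeff 0 = S ^ 3 ∧
    (dispersionPoly S T).coeff 1 = 2 * S ^ 2 + S ^ 3 * T ∧
    (dispersionPoly S T).coeff 3 = 3 * S * T ∧ (dispersionPoly S T).coeff 4 = T := by
  rw [dispersionPoly_eq]
  simp only [coeff_add, coeff_C_mul, coeff_X_pow, coeff_X, coeff_C]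
  norm_num

theorem dispersionPoly_neg (S T : ℝ) :
    dispersionPoly (-S) (-T) = -(dispersionPoly S T).comp (-X) := by
  simp [dispersionPoly]; ring

theorem coeff_one_prod {ι : Type*} (A : Finset ι) (f : ι → ℝ[X])
    (h : ∀ i ∈ A, (f i).coeff 0 ≠ 0) :
    (∏ i ∈ A, f i).coeff 1 =
      (∏ i ∈ A, (f i).coeff 0) * ∑ i ∈ A, (f i).coeff 1 / (f i).coeff 0 := by
  classical
  induction A using Finset.induction_on with
  | empty => simp [coeff_one]
  | insert a A ha ih =>
    have h0 := h a (mem_insert_self a A)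
    rw [prod_insert ha, prod_insert ha, sum_insert ha, mul_coeff_one,
      ih fun i hi => h i (mem_insert_of_mem hi), coeff_zero_prod]
    field_simp
    ring

/-- Reflection turns the two top coefficients of a product into its two lowest, to which
`coeff_one_prod` applies. -/
theorem reflect_prod {ι : Type*} (A : Finset ι) (f : ι → ℝ[X]) (d : ℕ)
    (h : ∀ i ∈ A, (f i).natDegree ≤ d) :
    reflect (d * #A) (∏ i ∈ A, f i) = ∏ i ∈ A, reflect d (f i) := by
  classical
  induction A using Finset.induction_on with
  | empty => simp
  | insert a A ha ih =>
    have h1 : (∏ i ∈ A, f i).natDegree ≤ d * #A := by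
      refine (natDegree_prod_le _ _).trans ?_
      refine (sum_le_card_nsmul _ _ d fun i hi => h i (mem_insert_of_mem hi)).trans ?_
      simp [mul_comm]
    rw [prod_insert ha, prod_insert ha, card_insert_of_notMem ha,
      show d * (#A + 1) = d + d * #A by ring,
      reflect_mul _ _ (h a (mem_insert_self a A)) h1,
      ih fun i hi => h i (mem_insert_of_mem hi)]

end ReducedOstrovsky

/-! ### The Hirota condition. -/

namespace ReducedOstrovsky

open Polynomial Finset

section HirotaCondition

variable {ι : Type*}

/-- The dispersion relation at signed wave numbers `κ`, up to the interaction weight. -/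
noncomputable def dispersion (A : Finset ι) (κ : ι → ℝ) : ℝ :=
  (∑ i ∈ A, κ i) ^ 3 * (∑ i ∈ A, (κ i)⁻¹) - (∑ i ∈ A, κ i) ^ 2

theorem dispersion_neg (A : Finset ι) (κ : ι → ℝ) : dispersion A (-κ) = dispersion A κ := by
  simp only [dispersion, Pi.neg_apply, inv_neg, sum_neg_distrib]
  ring

/-- The product of the polynomials `quartic X (κ j)`. -/
noncomputable def backgroundPoly (A : Finset ι) (κ : ι → ℝ) : ℝ[X] := ∏ j ∈ A, quarticPoly (κ j)

theorem backgroundPoly_neg (A : Finset ι) (κ : ι → ℝ) :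
    backgroundPoly A (-κ) = (backgroundPoly A κ).comp (-X) := by
  simp [backgroundPoly, Polynomial.prod_comp, quarticPoly_neg]

theorem eval_backgroundPoly (A : Finset ι) (κ : ι → ℝ) (x : ℝ) :
    (backgroundPoly A κ).eval x = ∏ j ∈ A, quartic x (κ j) := by
  simp [backgroundPoly, eval_prod, eval_quarticPoly]

theorem natDegree_backgroundPoly_le (A : Finset ι) (κ : ι → ℝ) :
    (backgroundPoly A κ).natDegree ≤ 4 * #A := by
  refine (natDegree_prod_le _ _).trans ?_
  refine (sum_le_card_nsmul _ _ 4 fun i _ => natDegree_quarticPoly_le _).trans ?_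
  simp [mul_comm]

theorem natDegree_dispersionPoly_mul_le (A : Finset ι) (κ : ι → ℝ) (S T : ℝ) :
    (dispersionPoly S T * backgroundPoly A κ).natDegree ≤ 4 + 4 * #A :=
  natDegree_mul_le_of_le (natDegree_dispersionPoly_le _ _) (natDegree_backgroundPoly_le _ _)

theorem ne_zero_of_eq_or_eq_neg {x y : ℝ} (h : x = y ∨ x = -y) (hy : y ≠ 0) : x ≠ 0 := by
  rcases h with rfl | rfl
  · exact hy
  · exact neg_ne_zero.mpr hy

theorem X_sub_C_sq_dvd_iff (p : ℝ[X]) (c : ℝ) :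
    (X - C c) ^ 2 ∣ p ↔ p.eval c = 0 ∧ (derivative p).eval c = 0 := by
  rcases eq_or_ne p 0 with rfl | hp
  · simp
  · rw [← le_rootMultiplicity_iff hp]
    exact one_lt_rootMultiplicity_iff_isRoot hp

theorem eval_derivative_backgroundPoly_neg (A : Finset ι) (κ : ι → ℝ) (x : ℝ) :
    (derivative (backgroundPoly A (-κ))).eval x = -(derivative (backgroundPoly A κ)).eval (-x) := by
  rw [backgroundPoly_neg, derivative_comp]
  simp

theorem eval_backgroundPoly_neg (A : Finset ι) (κ : ι → ℝ) (x : ℝ) :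
    (backgroundPoly A (-κ)).eval x = (backgroundPoly A κ).eval (-x) := by
  simp [backgroundPoly_neg]

theorem backgroundPoly_mul_neg_congr {A : Finset ι} {κ k : ι → ℝ}
    (h : ∀ i, κ i = k i ∨ κ i = -k i) :
    backgroundPoly A κ * backgroundPoly A (-κ) = backgroundPoly A k * backgroundPoly A (-k) := by
  simp only [backgroundPoly, ← prod_mul_distrib]
  refine prod_congr rfl fun i _ => ?_
  rcases h i with h | h
  · simp [h]
  · simp [h, mul_comm]

variable [LinearOrder ι]

/-- The product of the interaction quartics over all pairs in `A`. -/
noncomputable def quarticProd (A : Finset ι) (κ : ι → ℝ) : ℝ :=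
  pairProd A fun i j => quartic (κ i) (κ j)

theorem quarticProd_neg (A : Finset ι) (κ : ι → ℝ) : quarticProd A (-κ) = quarticProd A κ := by
  simp [quarticProd, quartic_neg_neg]

theorem quarticProd_congr {A : Finset ι} {κ κ' : ι → ℝ} (h : ∀ i ∈ A, κ i = κ' i) :
    quarticProd A κ = quarticProd A κ' :=
  pairProd_congr fun i hi j hj => by rw [h i hi, h j hj]

theorem quarticProd_insert {A : Finset ι} {a : ι} (ha : a ∉ A) (κ : ι → ℝ) :
    quarticProd (insert a A) κ = (∏ j ∈ A, quartic (κ a) (κ j)) * quarticProd A κ :=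
  pairProd_insert (fun _ _ => quartic_comm _ _) ha

/-- The summand of the Hirota condition for `A` and one more soliton, as a polynomial in the wave
number of the latter. -/
noncomputable def hirotaPoly (A : Finset ι) (κ : ι → ℝ) : ℝ[X] :=
  C (quarticProd A κ) *
    (dispersionPoly (∑ i ∈ A, κ i) (∑ i ∈ A, (κ i)⁻¹) * backgroundPoly A κ)

theorem hirotaPoly_neg (A : Finset ι) (κ : ι → ℝ) :
    hirotaPoly A (-κ) = -(hirotaPoly A κ).comp (-X) := by
  simp only [hirotaPoly, quarticProd_neg, Pi.neg_apply, inv_neg, sum_neg_distrib,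
    dispersionPoly_neg, backgroundPoly_neg, mul_comp, C_comp]
  ring

theorem eval_hirotaPoly {A : Finset ι} {a : ι} (ha : a ∉ A) (κ : ι → ℝ) (h0 : κ a ≠ 0) :
    (hirotaPoly A κ).eval (κ a) =
      κ a * (dispersion (insert a A) κ * quarticProd (insert a A) κ) := by
  rw [quarticProd_insert ha, dispersion, sum_insert ha, sum_insert ha]
  simp only [hirotaPoly, eval_mul, eval_C, eval_backgroundPoly, dispersionPoly, eval_sub, eval_add,
    eval_pow, eval_X, eval_one]
  field_simp

/-- With S = ∑κᵢ and T = ∑κᵢ⁻¹, the background contributes S³·(-3T) and the dispersion factor 2S² +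
S³T, which add up to -2(S³T - S²). The linear coefficient thus reproduces the Hirota summand with
the extra soliton removed. -/
theorem coeff_one_hirotaPoly (A : Finset ι) (κ : ι → ℝ) (h : ∀ i ∈ A, κ i ≠ 0) :
    (hirotaPoly A κ).coeff 1 =
      -2 * (∏ i ∈ A, κ i ^ 4) * (dispersion A κ * quarticProd A κ) := by
  have h1 : ∀ i, (quarticPoly (κ i)).coeff 0 = κ i ^ 4 := fun i => (coeff_quarticPoly _).1
  have h2 : ∀ i, (quarticPoly (κ i)).coeff 1 = -3 * κ i ^ 3 := fun i => (coeff_quarticPoly _).2.1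
  have h3 : (backgroundPoly A κ).coeff 1 = (∏ i ∈ A, κ i ^ 4) * (-3 * ∑ i ∈ A, (κ i)⁻¹) := by
    rw [backgroundPoly, coeff_one_prod]
    · simp only [h1, h2]
      rw [mul_sum A _ (-3 : ℝ)]
      congr 1
      refine sum_congr rfl fun i hi => ?_
      have := h i hi
      field_simp
    · intro i hi
      rw [h1]
      exact pow_ne_zero _ (h i hi)
  have h4 : (backgroundPoly A κ).coeff 0 = ∏ i ∈ A, κ i ^ 4 := by
    rw [backgroundPoly, coeff_zero_prod]
    simp only [h1]
  obtain ⟨h5, h6, -⟩ := coeff_dispersionPoly (∑ i ∈ A, κ i) (∑ i ∈ A, (κ i)⁻¹)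
  rw [hirotaPoly, coeff_C_mul, mul_coeff_one, h3, h4, h5, h6, dispersion]
  ring

/-- The contributions 3ST from the dispersion factor and T·(-3S) from the background cancel. -/
theorem coeff_hirotaPoly_subleading (A : Finset ι) (κ : ι → ℝ) :
    (hirotaPoly A κ).coeff (3 + 4 * #A) = 0 := by
  have h1 : ∀ i, (reflect 4 (quarticPoly (κ i))).coeff 0 = 1 := fun i => by
    rw [coeff_reflect, show revAt 4 0 = 4 from rfl, (coeff_quarticPoly _).2.2.2]
  have h2 : ∀ i, (reflect 4 (quarticPoly (κ i))).coeff 1 = -3 * κ i := fun i => by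
    rw [coeff_reflect, show revAt 4 1 = 3 from rfl, (coeff_quarticPoly _).2.2.1]
  obtain ⟨-, -, h3, h4⟩ := coeff_dispersionPoly (∑ i ∈ A, κ i) (∑ i ∈ A, (κ i)⁻¹)
  have h5 : (reflect (4 + 4 * #A) (dispersionPoly (∑ i ∈ A, κ i) (∑ i ∈ A, (κ i)⁻¹) *
      backgroundPoly A κ)).coeff 1 = 0 := by
    rw [reflect_mul _ _ (natDegree_dispersionPoly_le _ _) (natDegree_backgroundPoly_le _ _),
      backgroundPoly, reflect_prod _ _ _ fun i _ => natDegree_quarticPoly_le _, mul_coeff_one,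
      coeff_one_prod _ _ fun i _ => by simp [h1], coeff_zero_prod, coeff_reflect, coeff_reflect,
      show revAt 4 0 = 4 from rfl, show revAt 4 1 = 3 from rfl, h3, h4]
    simp only [h1, h2, prod_const_one, div_one, ← mul_sum]
    ring
  rw [coeff_reflect, revAt_le (by omega), show 4 + 4 * #A - 1 = 3 + 4 * #A by omega] at h5
  rw [hirotaPoly, coeff_C_mul, h5, mul_zero]

theorem hirotaPoly_insert_update {A : Finset ι} {a : ι} (ha : a ∉ A) (κ : ι → ℝ) (y : ℝ) :
    hirotaPoly (insert a A) (Function.update κ a y) =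
      C (quarticProd A κ * (backgroundPoly A κ).eval y) *
        (dispersionPoly (y + ∑ i ∈ A, κ i) (y⁻¹ + ∑ i ∈ A, (κ i)⁻¹) *
          (quarticPoly y * backgroundPoly A κ)) := by
  have h : ∀ i ∈ A, Function.update κ a y i = κ i := fun i hi =>
    Function.update_of_ne (fun h : i = a => ha (h ▸ hi)) _ _
  rw [hirotaPoly, quarticProd_insert ha, quarticProd_congr h, backgroundPoly, sum_insert ha,
    sum_insert ha, prod_insert ha, sum_congr rfl h,
    sum_congr rfl fun i hi => congrArg Inv.inv (h i hi), Function.update_self,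
    prod_congr rfl fun i hi => congrArg (quartic y) (h i hi),
    prod_congr rfl fun i hi => congrArg quarticPoly (h i hi), eval_backgroundPoly, backgroundPoly,
    mul_comm (quarticProd A κ)]

theorem hirotaPoly_congr {A : Finset ι} {κ κ' : ι → ℝ} (h : ∀ i ∈ A, κ i = κ' i) :
    hirotaPoly A κ = hirotaPoly A κ' := by
  rw [hirotaPoly, hirotaPoly, quarticProd_congr h, sum_congr rfl h,
    sum_congr rfl fun i hi => congrArg Inv.inv (h i hi), backgroundPoly, backgroundPoly,
    prod_congr rfl fun i hi => congrArg quarticPoly (h i hi)]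

variable [Fintype ι]

theorem signSum_hirotaPoly_comp_neg (A : Finset ι) (k : ι → ℝ) :
    (signSum k (hirotaPoly A)).comp (-X) = -signSum k (hirotaPoly A) := by
  nth_rewrite 2 [← signSum_neg]
  simp only [signSum, hirotaPoly_neg, sum_neg_distrib, neg_neg]
  exact Polynomial.sum_comp _ _ _

theorem coeff_signSum_hirotaPoly_of_even (A : Finset ι) (k : ι → ℝ) {n : ℕ} (hn : Even n) :
    (signSum k (hirotaPoly A)).coeff n = 0 := by
  have h := congrArg (fun p => p.coeff n) (signSum_hirotaPoly_comp_neg A k)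
  rw [show (-X : ℝ[X]) = C (-1) * X by simp] at h
  simp only [comp_C_mul_X_coeff, mul_one, hn.neg_one_pow, coeff_neg] at h
  linarith

theorem coeff_signSum_hirotaPoly (A : Finset ι) (k : ι → ℝ) (n : ℕ) :
    (signSum k (hirotaPoly A)).coeff n = signSum k fun κ => (hirotaPoly A κ).coeff n :=
  signSum_map k _ (lcoeff ℝ n).toAddMonoidHom

/-- Each summand has degree at most 4 + 4n; the top coefficient is lost to oddness of the sum and
the next one vanishes termwise. -/
theorem natDegree_signSum_hirotaPoly_le (A : Finset ι) (k : ι → ℝ) :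
    (signSum k (hirotaPoly A)).natDegree ≤ 2 + 4 * #A := by
  rw [natDegree_le_iff_coeff_eq_zero]
  intro n hn
  rcases (show n = 3 + 4 * #A ∨ n = 4 + 4 * #A ∨ 4 + 4 * #A < n by omega) with rfl | rfl | h
  · rw [coeff_signSum_hirotaPoly]
    exact sum_eq_zero (fun ε _ => coeff_hirotaPoly_subleading _ _)
  · exact coeff_signSum_hirotaPoly_of_even _ _ ⟨2 + 2 * #A, by ring⟩
  · rw [coeff_signSum_hirotaPoly]
    refine sum_eq_zero fun ε _ => ?_
    beta_reduce
    rw [hirotaPoly, coeff_C_mul, coeff_eq_zero_of_natDegree_lt, mul_zero]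
    exact (natDegree_dispersionPoly_mul_le _ _ _ _).trans_lt h

theorem X_pow_three_dvd_signSum_hirotaPoly {A : Finset ι} {k : ι → ℝ} (hk : ∀ i ∈ A, k i ≠ 0)
    (h : signSum k (fun κ => dispersion A κ * quarticProd A κ) = 0) :
    X ^ 3 ∣ signSum k (hirotaPoly A) := by
  rw [X_pow_dvd_iff]
  intro d hd
  interval_cases d
  · exact coeff_signSum_hirotaPoly_of_even _ _ Even.zero
  · rw [coeff_signSum_hirotaPoly, ← mul_zero (-2 * ∏ i ∈ A, k i ^ 4), ← h, ← signSum_const_mul]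
    refine signSum_congr fun κ hκ => ?_
    rw [coeff_one_hirotaPoly _ _ fun i hi => ne_zero_of_eq_or_eq_neg (hκ i) (hk i hi)]
    congr 2
    refine prod_congr rfl fun i _ => ?_
    rcases hκ i with h | h <;> rw [h]
    ring
  · exact coeff_signSum_hirotaPoly_of_even _ _ even_two

/-- The sign of `κ a` is fixed either way. If it is +, every summand contains the factor
`quarticPoly (k a)`, which has a double root there. If it is -, the new soliton at `k a` cancels
soliton `a` in both wave number sums, leaving the Hirota sum over `A`. -/
theorem X_sub_C_sq_dvd_signSum_hirotaPoly {A : Finset ι} {a : ι} (ha : a ∉ A) {k : ι → ℝ}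
    (hka : k a ≠ 0) (h : signSum k (fun κ => dispersion A κ * quarticProd A κ) = 0) :
    (X - C (k a)) ^ 2 ∣ signSum k (hirotaPoly (insert a A)) := by
  set c := k a with hc
  have h1 : (X - C c) ^ 2 ∣
      signSum k (fun κ => hirotaPoly (insert a A) (Function.update κ a c)) := by
    refine dvd_sum fun ε _ => ?_
    beta_reduce
    rw [hirotaPoly_insert_update ha]
    exact Dvd.dvd.mul_left (Dvd.dvd.mul_left (Dvd.dvd.mul_right (Dvd.intro _ rfl) _) _) _
  have h2 : (X - C c) ^ 2 ∣
      signSum k (fun κ => hirotaPoly (insert a A) (Function.update κ a (-c))) := by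
    set M := (backgroundPoly A k).eval c * (backgroundPoly A (-k)).eval c with hM
    set M' := (derivative (backgroundPoly A k * backgroundPoly A (-k))).eval c with hM'
    -- The background values at ±c multiply to a quantity independent of the signs, so they factor
    -- out of the sum.
    have hκM : ∀ κ : ι → ℝ, (∀ i, κ i = k i ∨ κ i = -k i) →
        (backgroundPoly A κ).eval c * (backgroundPoly A κ).eval (-c) = M := by
      intro κ hκ
      rw [← eval_backgroundPoly_neg, hM, ← eval_mul, ← eval_mul, backgroundPoly_mul_neg_congr hκ]
    rw [X_sub_C_sq_dvd_iff]
    constructor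
    · rw [← coe_evalRingHom]
      refine (signSum_map k _ (evalRingHom c).toAddMonoidHom).trans ?_
      rw [← mul_zero (c * (quarticPoly (-c)).eval c * M), ← h, ← signSum_const_mul]
      refine signSum_congr fun κ hκ => ?_
      rw [← hκM κ hκ, hirotaPoly_insert_update ha]
      simp only [dispersion]
      generalize ∑ i ∈ A, κ i = S, ∑ i ∈ A, (κ i)⁻¹ = T, backgroundPoly A κ = B
      simp [dispersionPoly]
      field_simp
      ring
    -- The derivative at c splits into multiples of the Hirota summand, a part `D` from
    -- differentiating the background, and a part `O` odd in κ. `D` sums to zero because `D κ + D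
    -- (-κ)` is the Hirota summand times the sign-independent derivative `M'`.
    · set D : (ι → ℝ) → ℝ := fun κ => dispersion A κ * quarticProd A κ *
        ((derivative (backgroundPoly A κ)).eval c * (backgroundPoly A κ).eval (-c)) with hD
      have hDsum : signSum k D = 0 := by
        have e1 : signSum k D + signSum k (fun κ => D (-κ)) = 0 := by
          rw [← signSum_add, ← mul_zero M', ← h, ← signSum_const_mul]
          refine signSum_congr fun κ hκ => ?_
          rw [hM', ← backgroundPoly_mul_neg_congr hκ, derivative_mul]
          simp only [hD, dispersion_neg, quarticProd_neg, eval_add, eval_mul,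
            eval_derivative_backgroundPoly_neg, eval_backgroundPoly_neg, neg_neg]
          ring
        rw [signSum_neg] at e1
        linarith
      set O : (ι → ℝ) → ℝ := fun κ => quarticProd A κ *
        (3 * c * (∑ i ∈ A, κ i) ^ 2 * (∑ i ∈ A, (κ i)⁻¹) - (∑ i ∈ A, κ i) ^ 3 / c -
          2 * c * ∑ i ∈ A, κ i) with hO
      have hOsum : signSum k O = 0 := by
        refine signSum_eq_zero_of_odd fun κ => ?_
        simp only [hO, quarticProd_neg, Pi.neg_apply, inv_neg, sum_neg_distrib]
        ring
      set q := (quarticPoly (-c)).eval c with hq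
      set q' := (derivative (quarticPoly (-c))).eval c with hq'
      have e2 : signSum k (fun κ => (M * q + M * c * q') * (dispersion A κ * quarticProd A κ) +
          (M * q * O κ + c * q * D κ)) = 0 := by
        rw [signSum_add, signSum_add, signSum_const_mul, signSum_const_mul, signSum_const_mul, h,
          hDsum, hOsum]
        ring
      rw [← e2]
      refine (signSum_map k _
        ((evalRingHom c).toAddMonoidHom.comp (derivative (R := ℝ)).toAddMonoidHom)).trans ?_
      refine signSum_congr fun κ hκ => ?_
      rw [← hκM κ hκ, hirotaPoly_insert_update ha]
      simp only [dispersion, hO, hD]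
      generalize ∑ i ∈ A, κ i = S, ∑ i ∈ A, (κ i)⁻¹ = T, backgroundPoly A κ = B
      simp [dispersionPoly, ← hq, ← hq', derivative_mul, derivative_pow]
      field_simp
      ring
  have h3 := dvd_add h1 h2
  rw [hc, ← two_signSum, ← two_mul] at h3
  exact (((isUnit_iff_ne_zero.mpr two_ne_zero : IsUnit (2 : ℝ)).map C).dvd_mul_left).mp h3

theorem X_add_C_sq_dvd_of_dvd {p : ℝ[X]} {c : ℝ} (hp : p.comp (-X) = -p)
    (h : (X - C c) ^ 2 ∣ p) : (X + C c) ^ 2 ∣ p := by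
  obtain ⟨r, hr⟩ := h
  refine ⟨-r.comp (-X), ?_⟩
  rw [← neg_neg p, ← hp]
  nth_rewrite 1 [hr]
  simp only [mul_comp, pow_comp, sub_comp, X_comp, C_comp]
  ring

theorem isCoprime_of_sub_eq_C {p q : ℝ[X]} {c : ℝ} (hc : c ≠ 0) (h : p - q = C c) :
    IsCoprime p q := by
  refine ⟨C c⁻¹, -C c⁻¹, ?_⟩
  calc C c⁻¹ * p + -C c⁻¹ * q = C c⁻¹ * (p - q) := by ring
    _ = 1 := by rw [h, ← C_mul, inv_mul_cancel₀ hc, C_1]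

theorem hirota_condition (A : Finset ι) (k : ι → ℝ) (h0 : ∀ i ∈ A, k i ≠ 0)
    (hne : ∀ i ∈ A, ∀ j ∈ A, i ≠ j → k i ^ 2 ≠ k j ^ 2) :
    signSum k (fun κ => dispersion A κ * quarticProd A κ) = 0 := by
  induction A using Finset.strongInduction with
  | H A ih =>
  rcases A.eq_empty_or_nonempty with rfl | ⟨a, ha⟩
  · exact sum_eq_zero fun ε _ => by simp [dispersion]
  obtain ⟨B, haB, rfl⟩ : ∃ B, a ∉ B ∧ insert a B = A := ⟨A.erase a, by simp, insert_erase ha⟩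
  have ih' : ∀ D ⊆ B, signSum k (fun κ => dispersion D κ * quarticProd D κ) = 0 := fun D hD =>
    have hDA : D ⊆ insert a B := hD.trans (subset_insert a B)
    ih D ⟨hDA, fun h => haB (hD (h (mem_insert_self a B)))⟩ (fun i hi => h0 i (hDA hi))
      fun i hi j hj => hne i (hDA hi) j (hDA hj)
  have h0B : ∀ i ∈ B, k i ≠ 0 := fun i hi => h0 i (mem_insert_of_mem hi)
  have hF : signSum k (hirotaPoly B) = 0 := by
    set F := signSum k (hirotaPoly B) with hF
    have hodd : F.comp (-X) = -F := signSum_hirotaPoly_comp_neg B k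
    have hj : ∀ j ∈ B, (X ^ 2 - C (k j ^ 2)) ^ 2 ∣ F := by
      intro j hj
      have h1 : (X - C (k j)) ^ 2 ∣ F := by
        rw [hF, ← insert_erase hj]
        exact X_sub_C_sq_dvd_signSum_hirotaPoly (notMem_erase j B) (h0B j hj)
          (ih' _ (erase_subset j B))
      have h2 := X_add_C_sq_dvd_of_dvd hodd h1
      have h3 : IsCoprime (X + C (k j)) (X - C (k j)) :=
        isCoprime_of_sub_eq_C (mul_ne_zero two_ne_zero (h0B j hj)) (by
          simp only [C_mul, map_ofNat]; ring)
      have h4 := (h3.pow (m := 2) (n := 2)).mul_dvd h2 h1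
      rwa [← mul_pow, show (X + C (k j)) * (X - C (k j)) = X ^ 2 - C (k j ^ 2) by
        simp only [map_pow]; ring] at h4
    have h5 : ∏ j ∈ B, (X ^ 2 - C (k j ^ 2)) ^ 2 ∣ F := by
      refine prod_dvd_of_coprime (fun i hi j hj' hij => ?_) hj
      refine (isCoprime_of_sub_eq_C (sub_ne_zero.mpr (hne j (mem_insert_of_mem hj') i
        (mem_insert_of_mem hi) hij.symm)) ?_).pow
      rw [C_sub]
      ring
    -- X³ and the double factors have total degree 3 + 4n, one more than the degree bound on `F`.
    have h6 : IsCoprime (X ^ 3) (∏ j ∈ B, (X ^ 2 - C (k j ^ 2)) ^ 2) := by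
      refine IsCoprime.prod_right fun j hj => IsCoprime.pow ?_
      refine (IsCoprime.pow_left_iff two_pos).mp ?_
      exact isCoprime_of_sub_eq_C (pow_ne_zero 2 (h0B j hj)) (by ring)
    have h7 := h6.mul_dvd (X_pow_three_dvd_signSum_hirotaPoly h0B (ih' B subset_rfl)) h5
    refine eq_zero_of_dvd_of_natDegree_lt h7 ?_
    refine (natDegree_signSum_hirotaPoly_le B k).trans_lt ?_
    have h8 : ∀ j ∈ B, ((X ^ 2 - C (k j ^ 2) : ℝ[X]) ^ 2).Monic := fun j _ =>
      (monic_X_pow_sub_C _ two_ne_zero).pow 2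
    rw [(monic_X_pow 3).natDegree_mul (monic_prod_of_monic _ _ h8), natDegree_prod_of_monic _ _ h8]
    simp only [natDegree_pow, natDegree_X_pow_sub_C, natDegree_X, sum_const, smul_eq_mul]
    omega
  have h9 : signSum k (fun κ => k a * (dispersion (insert a B) κ * quarticProd (insert a B) κ)) =
      (signSum k (hirotaPoly B)).eval (k a) := by
    -- The summand is even, so the sign at `a` may be fixed to +; the sum is then `F` evaluated at
    -- `k a`.
    rw [signSum_update_of_even k a fun κ => by rw [dispersion_neg, quarticProd_neg]]
    refine Eq.trans ?_ (signSum_map k _ (evalRingHom (k a)).toAddMonoidHom).symm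
    refine signSum_congr fun κ _ => ?_
    have h := eval_hirotaPoly haB (Function.update κ a (k a))
    rw [Function.update_self, hirotaPoly_congr (κ' := κ) fun i hi =>
      Function.update_of_ne (fun h : i = a => haB (h ▸ hi)) _ _] at h
    exact (h (h0 a (mem_insert_self a B))).symm
  rw [hF, eval_zero, signSum_const_mul] at h9
  exact (mul_eq_zero.mp h9).resolve_left (h0 a (mem_insert_self a B))

end HirotaCondition

end ReducedOstrovsky

/-! ### The bilinear equation for τ. -/

namespace ReducedOstrovsky

open Finset

section Bilinear

variable {N : ℕ}

theorem quartic_pos {x y : ℝ} (hx : x ≠ 0) (h : x ≠ y) : 0 < quartic x y := by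
  have h1 : 0 < x ^ 2 := by positivity
  have h2 : 0 < (x - y) ^ 2 := by
    have := sub_ne_zero.mpr h
    positivity
  exact mul_pos h2 (by nlinarith [sq_nonneg (x - 2 * y)])

theorem coeffB_eq (k : Fin N → ℝ) (i j : Fin N) :
    coeffB k i j = quartic (k i) (k j) / quartic (k i) (-k j) := by
  unfold coeffB quartic
  congr 1
  ring

/-- The wave number `∑ μᵢ kᵢ` of a term of the `τ`-function with respect to `x₁`. -/
def freqFst (k : Fin N → ℝ) (μ : Fin N → Fin 2) : ℝ := ∑ i, ((μ i : ℕ) : ℝ) * k i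

/-- The wave number `∑ 3 μᵢ / kᵢ` of a term of the `τ`-function with respect to `x₋₁`. -/
noncomputable def freqSnd (k : Fin N → ℝ) (μ : Fin N → Fin 2) : ℝ :=
  ∑ i, ((μ i : ℕ) : ℝ) * (3 / k i)

/-- The logarithm of the amplitude of a term of the `τ`-function. -/
noncomputable def logAmplitude (k η₀ : Fin N → ℝ) (μ : Fin N → Fin 2) : ℝ :=
  ∑ i, ((μ i : ℕ) : ℝ) * η₀ i +
    ∑ i, ∑ j ∈ Ioi i, ((μ i : ℕ) : ℝ) * ((μ j : ℕ) : ℝ) * Real.log (coeffB k i j)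

/-- A term of the `τ`-function. -/
noncomputable def tauTerm (k η₀ : Fin N → ℝ) (p : ℝ × ℝ) (μ : Fin N → Fin 2) : ℝ :=
  Real.exp (logAmplitude k η₀ μ) * Real.exp (freqFst k μ * p.1 + freqSnd k μ * p.2)

theorem tauTerm_eq (k η₀ : Fin N → ℝ) (p : ℝ × ℝ) (μ : Fin N → Fin 2) :
    tauTerm k η₀ p μ = Real.exp (∑ i, ((μ i : ℕ) : ℝ) * phase k η₀ i p +
      ∑ i, ∑ j ∈ Ioi i, ((μ i : ℕ) : ℝ) * ((μ j : ℕ) : ℝ) * Real.log (coeffB k i j)) := by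
  have h : ∑ i, ((μ i : ℕ) : ℝ) * phase k η₀ i p =
      freqFst k μ * p.1 + freqSnd k μ * p.2 + ∑ i, ((μ i : ℕ) : ℝ) * η₀ i := by
    simp only [freqFst, freqSnd, phase, sum_mul, ← sum_add_distrib]
    exact sum_congr rfl fun i _ => by ring
  rw [tauTerm, ← Real.exp_add, h, logAmplitude]
  congr 1
  ring

theorem tau_eq (k η₀ : Fin N → ℝ) (p : ℝ × ℝ) : tau k η₀ p = ∑ μ, tauTerm k η₀ p μ :=
  sum_congr rfl fun μ _ => (tauTerm_eq k η₀ p μ).symm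

theorem pairProd_eq_prod_Ioi {M : Type*} [CommMonoid M] (A : Finset (Fin N))
    (f : Fin N → Fin N → M) :
    pairProd A f = ∏ i, ∏ j ∈ Ioi i, if i ∈ A ∧ j ∈ A then f i j else 1 := by
  have h : ∀ i, ∏ j ∈ Ioi i, (if i ∈ A ∧ j ∈ A then f i j else 1) =
      ∏ j, if i < j then (if i ∈ A ∧ j ∈ A then f i j else 1) else 1 := by
    intro i
    rw [show Ioi i = univ.filter (i < ·) by ext j; simp, prod_filter]
  simp only [h, pairProd]
  rw [← prod_subset (subset_univ A) fun i _ hi => prod_eq_one fun j _ => by simp [hi]]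
  refine prod_congr rfl fun i hi => ?_
  rw [← prod_subset (subset_univ A) fun j _ hj => by simp [hj]]
  exact prod_congr rfl fun j hj => by simp [hi, hj]

/-- Exchange the entries of a pair of multi-indices at the places where `ε = -1`. -/
def signSwap (ε : Fin N → ℤˣ) (P : (Fin N → Fin 2) × (Fin N → Fin 2)) :
    (Fin N → Fin 2) × (Fin N → Fin 2) :=
  (fun i => if ε i = 1 then P.1 i else P.2 i, fun i => if ε i = 1 then P.2 i else P.1 i)

theorem signSwap_involutive (ε : Fin N → ℤˣ) : Function.Involutive (signSwap ε) := by
  intro P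
  ext i <;> by_cases h : ε i = 1 <;> simp [signSwap, h]

/-- The bilinear form of the reduced Ostrovsky equation, on a pair of terms of `τ`. -/
noncomputable def bilinearTerm (k η₀ : Fin N → ℝ) (p : ℝ × ℝ)
    (P : (Fin N → Fin 2) × (Fin N → Fin 2)) : ℝ :=
  ((freqFst k P.1 - freqFst k P.2) ^ 3 * (freqSnd k P.1 - freqSnd k P.2) -
    3 * (freqFst k P.1 - freqFst k P.2) ^ 2) * (tauTerm k η₀ p P.1 * tauTerm k η₀ p P.2)

theorem sub_eq_one_or_neg_one {a b : Fin 2} (h : a ≠ b) :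
    (((a : ℕ) : ℝ) - ((b : ℕ) : ℝ) = 1) ∨ (((a : ℕ) : ℝ) - ((b : ℕ) : ℝ) = -1) := by
  fin_cases a <;> fin_cases b <;> simp at h ⊢

/-- If the two indices differ at both places, the pair contributes B or 1 according to the relative
sign. Over the common denominator `quartic x (-y)` both are values of `quartic` at signed arguments.
If they agree at one of the places, exchanging entries changes nothing. -/
theorem exp_pair_signSwap {x y B : ℝ} (hB : B = quartic x y / quartic x (-y))
    (hxy : 0 < quartic x y) (hxy' : 0 < quartic x (-y)) (a a' b b' : Fin 2) (e e' : ℤˣ) :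
    Real.exp (((((if e = 1 then a else b : Fin 2) : ℕ) : ℝ) *
        (((if e' = 1 then a' else b' : Fin 2) : ℕ) : ℝ) +
        (((if e = 1 then b else a : Fin 2) : ℕ) : ℝ) *
        (((if e' = 1 then b' else a' : Fin 2) : ℕ) : ℝ)) * Real.log B) =
      (if a ≠ b ∧ a' ≠ b' then (quartic x (-y))⁻¹ else
        Real.exp ((((a : ℕ) : ℝ) * ((a' : ℕ) : ℝ) + ((b : ℕ) : ℝ) * ((b' : ℕ) : ℝ)) *
          Real.log B)) *
      (if a ≠ b ∧ a' ≠ b' then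
        quartic (((e : ℤ) : ℝ) * ((((a : ℕ) : ℝ) - ((b : ℕ) : ℝ)) * x))
          (((e' : ℤ) : ℝ) * ((((a' : ℕ) : ℝ) - ((b' : ℕ) : ℝ)) * y)) else 1) := by
  have hBpos : 0 < B := hB ▸ div_pos hxy hxy'
  have h1 : Real.exp (Real.log B) = (quartic x (-y))⁻¹ * quartic x y := by
    rw [Real.exp_log hBpos, hB, div_eq_inv_mul]
  have h2 : (quartic x (-y))⁻¹ * quartic x (-y) = 1 := inv_mul_cancel₀ hxy'.ne'
  have h3 : quartic (-x) y = quartic x (-y) := by rw [← quartic_neg_neg, neg_neg]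
  rcases Int.units_eq_one_or e with rfl | rfl <;> rcases Int.units_eq_one_or e' with rfl | rfl <;>
    fin_cases a <;> fin_cases a' <;> fin_cases b <;> fin_cases b' <;>
    simp [h1, h2, h3, quartic_neg_neg]

variable {k : Fin N → ℝ}

theorem tauTerm_mul_signSwap (hk : ∀ i, k i ≠ 0)
    (hkk : ∀ i j, i ≠ j → k i ≠ k j ∧ k i ≠ -k j) (η₀ : Fin N → ℝ) (p : ℝ × ℝ)
    (P : (Fin N → Fin 2) × (Fin N → Fin 2)) : ∃ c : ℝ, ∀ ε : Fin N → ℤˣ,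
      tauTerm k η₀ p (signSwap ε P).1 * tauTerm k η₀ p (signSwap ε P).2 =
        c * quarticProd (univ.filter fun i => P.1 i ≠ P.2 i) fun i =>
          ((ε i : ℤ) : ℝ) * ((((P.1 i : ℕ) : ℝ) - ((P.2 i : ℕ) : ℝ)) * k i) := by
  refine ⟨Real.exp (∑ i, (((P.1 i : ℕ) : ℝ) + ((P.2 i : ℕ) : ℝ)) * phase k η₀ i p) *
    ∏ i, ∏ j ∈ Ioi i, if P.1 i ≠ P.2 i ∧ P.1 j ≠ P.2 j then (quartic (k i) (-k j))⁻¹ else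
      Real.exp ((((P.1 i : ℕ) : ℝ) * ((P.1 j : ℕ) : ℝ) + ((P.2 i : ℕ) : ℝ) * ((P.2 j : ℕ) : ℝ)) *
        Real.log (coeffB k i j)), fun ε => ?_⟩
  rw [quarticProd, pairProd_eq_prod_Ioi, mul_assoc, ← prod_mul_distrib, tauTerm_eq, tauTerm_eq,
    ← Real.exp_add, add_add_add_comm, Real.exp_add, ← sum_add_distrib, ← sum_add_distrib]
  refine congrArg₂ (· * ·) (congrArg Real.exp (sum_congr rfl fun i _ => ?_)) ?_
  · by_cases h : ε i = 1
    · simp [signSwap, h]; ring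
    · simp [signSwap, h]; ring
  · rw [Real.exp_sum]
    refine prod_congr rfl fun i _ => ?_
    rw [← prod_mul_distrib, ← sum_add_distrib, Real.exp_sum]
    refine prod_congr rfl fun j hj => ?_
    have hij := hkk i j (mem_Ioi.mp hj).ne
    have h := exp_pair_signSwap (coeffB_eq k i j) (quartic_pos (hk i) hij.1)
      (quartic_pos (hk i) hij.2) (P.1 i) (P.1 j) (P.2 i) (P.2 j) (ε i) (ε j)
    simp only [mem_filter, mem_univ, true_and]
    rw [← h, add_mul]
    rfl

theorem freq_sub_signSwap (f : Fin N → ℝ) (P : (Fin N → Fin 2) × (Fin N → Fin 2))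
    (ε : Fin N → ℤˣ) :
    ∑ i, (((signSwap ε P).1 i : ℕ) : ℝ) * f i - ∑ i, (((signSwap ε P).2 i : ℕ) : ℝ) * f i =
      ∑ i ∈ univ.filter fun i => P.1 i ≠ P.2 i,
        ((ε i : ℤ) : ℝ) * ((((P.1 i : ℕ) : ℝ) - ((P.2 i : ℕ) : ℝ)) * f i) := by
  rw [← sum_sub_distrib, sum_filter]
  refine sum_congr rfl fun i _ => ?_
  by_cases hP : P.1 i = P.2 i
  · rcases Int.units_eq_one_or (ε i) with h | h <;> simp [signSwap, h, hP]
  · rcases Int.units_eq_one_or (ε i) with h | h <;> simp [signSwap, h, hP] <;> ring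

theorem sum_bilinearTerm_signSwap (hk : ∀ i, k i ≠ 0)
    (hkk : ∀ i j, i ≠ j → k i ≠ k j ∧ k i ≠ -k j) (η₀ : Fin N → ℝ) (p : ℝ × ℝ)
    (P : (Fin N → Fin 2) × (Fin N → Fin 2)) :
    ∑ ε : Fin N → ℤˣ, bilinearTerm k η₀ p (signSwap ε P) = 0 := by
  obtain ⟨c, hc⟩ := tauTerm_mul_signSwap hk hkk η₀ p P
  set A := univ.filter fun i => P.1 i ≠ P.2 i with hA
  set k' : Fin N → ℝ := fun i => (((P.1 i : ℕ) : ℝ) - ((P.2 i : ℕ) : ℝ)) * k i with hk'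
  have hA' : ∀ i ∈ A, k' i = k i ∨ k' i = -k i := by
    intro i hi
    rcases sub_eq_one_or_neg_one (mem_filter.mp hi).2 with h | h <;> simp [hk', h]
  have h := hirota_condition A k'
    (fun i hi => ne_zero_of_eq_or_eq_neg (hA' i hi) (hk i))
    (fun i hi j hj hij => by
      rw [sq_eq_sq_iff_eq_or_eq_neg.mpr (hA' i hi), sq_eq_sq_iff_eq_or_eq_neg.mpr (hA' j hj), Ne,
        sq_eq_sq_iff_eq_or_eq_neg, not_or]
      exact hkk i j hij)
  rw [← mul_zero (3 * c), ← h, ← signSum_const_mul]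
  refine sum_congr rfl fun ε _ => ?_
  beta_reduce
  have h1 : freqFst k (signSwap ε P).1 - freqFst k (signSwap ε P).2 =
      ∑ i ∈ A, ((ε i : ℤ) : ℝ) * k' i := freq_sub_signSwap k P ε
  have h2 : freqSnd k (signSwap ε P).1 - freqSnd k (signSwap ε P).2 =
      3 * ∑ i ∈ A, (((ε i : ℤ) : ℝ) * k' i)⁻¹ := by
    refine (freq_sub_signSwap _ P ε).trans ?_
    rw [mul_sum]
    refine sum_congr rfl fun i hi => ?_
    have h0 := hk i
    rcases sub_eq_one_or_neg_one (mem_filter.mp hi).2 with h | h <;>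
      rcases Int.units_eq_one_or (ε i) with h' | h' <;> simp [hk', h, h'] <;> field_simp
  rw [bilinearTerm, hc, h1, h2, dispersion]
  ring

/-- Every `signSwap ε` permutes the pairs, so averaging over `ε` does not change the total, and each
average is zero. -/
theorem sum_bilinearTerm (hk : ∀ i, k i ≠ 0)
    (hkk : ∀ i j, i ≠ j → k i ≠ k j ∧ k i ≠ -k j) (η₀ : Fin N → ℝ) (p : ℝ × ℝ) :
    ∑ P, bilinearTerm k η₀ p P = 0 := by
  have h1 : ∑ ε : Fin N → ℤˣ, ∑ P, bilinearTerm k η₀ p (signSwap ε P) = 0 := by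
    rw [sum_comm]
    exact sum_eq_zero fun P _ => sum_bilinearTerm_signSwap hk hkk η₀ p P
  have h2 : ∀ ε : Fin N → ℤˣ, ∑ P, bilinearTerm k η₀ p (signSwap ε P) =
      ∑ P, bilinearTerm k η₀ p P := fun ε =>
    Fintype.sum_equiv (signSwap_involutive ε).toPerm _ _ fun P => rfl
  simp only [h2, sum_const, smul_eq_zero] at h1
  exact h1.resolve_left (card_ne_zero.mpr univ_nonempty)

end Bilinear

end ReducedOstrovsky

/-! ### Moments of exponential sums: derivatives, density and integrability. -/

namespace ReducedOstrovsky

open Finset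

theorem integrableOn_Iic_deriv_of_nonpos {f f' : ℝ → ℝ} {l : ℝ}
    (hd : ∀ x, HasDerivAt f (f' x) x) (hf' : ∀ x, f' x ≤ 0)
    (hlim : Filter.Tendsto f Filter.atBot (nhds l)) (a : ℝ) :
    MeasureTheory.IntegrableOn f' (Set.Iic a) := by
  rw [← (MeasureTheory.Measure.measurePreserving_neg
    MeasureTheory.volume).integrableOn_comp_preimage (Homeomorph.neg ℝ).measurableEmbedding]
  have h1 : (Neg.neg ⁻¹' Set.Iic a : Set ℝ) = Set.Ici (-a) := by simp
  have h2 := MeasureTheory.integrableOn_Ioi_deriv_of_nonneg' (a := -a)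
    (g := fun x => f (-x)) (g' := fun x => -f' (-x))
    (fun x _ => ((hd (-x)).scomp x (hasDerivAt_neg x)).congr_deriv (by simp))
    (fun x _ => neg_nonneg.mpr (hf' _)) (hlim.comp Filter.tendsto_neg_atTop_atBot)
  rw [h1, integrableOn_Ici_iff_integrableOn_Ioi]
  simpa [Function.comp_def] using h2.neg

section Moments

variable {ι : Type*} (c K L : ι → ℝ)

/-- A term of an exponential sum in two variables. -/
noncomputable def expTerm (p : ℝ × ℝ) (i : ι) : ℝ := c i * Real.exp (K i * p.1 + L i * p.2)

variable {c} in
theorem expTerm_pos (hc : ∀ i, 0 < c i) (p : ℝ × ℝ) (i : ι) : 0 < expTerm c K L p i :=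
  mul_pos (hc i) (Real.exp_pos _)

variable [Fintype ι]

/-- The weighted mean of `Kᵃ Lᵇ` with respect to the weights `c exp (K x + L y)`. -/
noncomputable def expMean (a b : ℕ) (p : ℝ × ℝ) : ℝ :=
  (∑ i, K i ^ a * L i ^ b * expTerm c K L p i) / ∑ i, expTerm c K L p i

variable {c}

theorem sum_expTerm_pos [Nonempty ι] (hc : ∀ i, 0 < c i) (p : ℝ × ℝ) :
    0 < ∑ i, expTerm c K L p i :=
  sum_pos (fun i _ => expTerm_pos K L hc p i) univ_nonempty

theorem hasDerivAt_moment_fst (a b : ℕ) (p : ℝ × ℝ) :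
    HasDerivAt (fun s => ∑ i, K i ^ a * L i ^ b * expTerm c K L (s, p.2) i)
      (∑ i, K i ^ (a + 1) * L i ^ b * expTerm c K L p i) p.1 := by
  refine HasDerivAt.fun_sum fun i _ => ?_
  have h := ((((hasDerivAt_id p.1).const_mul (K i)).add_const (L i * p.2)).exp.const_mul
    (c i)).const_mul (K i ^ a * L i ^ b)
  refine h.congr_deriv ?_
  simp only [expTerm, id]
  ring

theorem hasDerivAt_moment_snd (a b : ℕ) (p : ℝ × ℝ) :
    HasDerivAt (fun s => ∑ i, K i ^ a * L i ^ b * expTerm c K L (p.1, s) i)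
      (∑ i, K i ^ a * L i ^ (b + 1) * expTerm c K L p i) p.2 := by
  refine HasDerivAt.fun_sum fun i _ => ?_
  have h := ((((hasDerivAt_id p.2).const_mul (L i)).const_add (K i * p.1)).exp.const_mul
    (c i)).const_mul (K i ^ a * L i ^ b)
  refine h.congr_deriv ?_
  simp only [expTerm, id]
  ring

variable [Nonempty ι]

theorem hasDerivAt_expMean_fst (hc : ∀ i, 0 < c i) (a b : ℕ) (p : ℝ × ℝ) :
    HasDerivAt (fun s => expMean c K L a b (s, p.2))
      (expMean c K L (a + 1) b p - expMean c K L a b p * expMean c K L 1 0 p) p.1 := by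
  have h0 := (sum_expTerm_pos K L hc p).ne'
  have h1 := hasDerivAt_moment_fst (c := c) K L 0 0 p
  simp only [pow_zero, one_mul] at h1
  refine ((hasDerivAt_moment_fst K L a b p).div h1 h0).congr_deriv ?_
  simp only [expMean, Prod.mk.eta, pow_zero, mul_one, zero_add]
  field_simp

theorem hasDerivAt_expMean_snd (hc : ∀ i, 0 < c i) (a b : ℕ) (p : ℝ × ℝ) :
    HasDerivAt (fun s => expMean c K L a b (p.1, s))
      (expMean c K L a (b + 1) p - expMean c K L a b p * expMean c K L 0 1 p) p.2 := by
  have h0 := (sum_expTerm_pos K L hc p).ne'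
  have h1 := hasDerivAt_moment_snd (c := c) K L 0 0 p
  simp only [pow_zero, one_mul] at h1
  refine ((hasDerivAt_moment_snd K L a b p).div h1 h0).congr_deriv ?_
  simp only [expMean, Prod.mk.eta, pow_zero, one_mul, zero_add]
  field_simp

theorem hasDerivAt_log_sum_expTerm_fst (hc : ∀ i, 0 < c i) (p : ℝ × ℝ) :
    HasDerivAt (fun s => Real.log (∑ i, expTerm c K L (s, p.2) i)) (expMean c K L 1 0 p) p.1 := by
  have h1 := hasDerivAt_moment_fst (c := c) K L 0 0 p
  simp only [pow_zero, one_mul] at h1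
  refine (h1.log (sum_expTerm_pos K L hc p).ne').congr_deriv ?_
  simp [expMean]

theorem contDiff_expMean (hc : ∀ i, 0 < c i) (a b : ℕ) : ContDiff ℝ ∞ (expMean c K L a b) := by
  have h0 := fun p => (sum_expTerm_pos K L hc p).ne'
  unfold expMean
  refine ContDiff.div ?_ ?_ h0 <;> (unfold expTerm; fun_prop)

theorem analyticAt_expMean_snd (hc : ∀ i, 0 < c i) (a b : ℕ) (x y : ℝ) :
    AnalyticAt ℝ (fun s => expMean c K L a b (x, s)) y := by
  have h0 := (sum_expTerm_pos K L hc (x, y)).ne'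
  unfold expMean
  refine AnalyticAt.div ?_ ?_ h0 <;> (unfold expTerm; fun_prop)

theorem sq_expMean_one_zero_le (hc : ∀ i, 0 < c i) (p : ℝ × ℝ) :
    expMean c K L 1 0 p ^ 2 ≤ expMean c K L 2 0 p := by
  have h0 := sum_expTerm_pos K L hc p
  have h := sum_mul_sq_le_sq_mul_sq univ (fun i => K i * √(expTerm c K L p i))
    (fun i => √(expTerm c K L p i))
  have h1 : ∀ i, √(expTerm c K L p i) ^ 2 = expTerm c K L p i := fun i =>
    Real.sq_sqrt (expTerm_pos K L hc p i).le
  simp only [mul_assoc, ← sq, mul_pow, h1] at h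
  simp only [expMean, pow_one, pow_zero, mul_one]
  rw [div_pow, div_le_div_iff₀ (by positivity) h0]
  nlinarith

theorem abs_expMean_one_zero_le (hc : ∀ i, 0 < c i) (p : ℝ × ℝ) :
    |expMean c K L 1 0 p| ≤ ∑ i, |K i| := by
  have h0 := sum_expTerm_pos K L hc p
  rw [expMean, abs_div, abs_of_pos h0, div_le_iff₀ h0, mul_sum]
  refine (abs_sum_le_sum_abs _ _).trans (sum_le_sum fun i _ => ?_)
  rw [abs_mul, abs_of_pos (expTerm_pos K L hc p i), pow_one, pow_zero, mul_one]
  exact mul_le_mul_of_nonneg_right (single_le_sum (f := fun i => |K i|)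
    (fun j _ => abs_nonneg _) (mem_univ i)) (expTerm_pos K L hc p i).le

/-- The Jacobian `∂x/∂x₋₁` of the hodograph transformation does not vanish on a whole line. -/
theorem exists_expMean_cross_ne (hc : ∀ i, 0 < c i) (x : ℝ) :
    ∃ y, 1 - 2 * (expMean c K L 1 1 (x, y) - expMean c K L 1 0 (x, y) * expMean c K L 0 1 (x, y))
      ≠ 0 := by
  by_contra! h
  set f : ℝ → ℝ := fun y => y - 2 * expMean c K L 1 0 (x, y) with hf
  have hd : ∀ y, HasDerivAt f 0 y := fun y =>
    ((hasDerivAt_id y).sub ((hasDerivAt_expMean_snd K L hc 1 0 (x, y)).const_mul 2)).congr_deriv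
      (h y)
  -- The term 2·`expMean` varies by at most 4∑|Kᵢ| along the line, so `f` must differ at 0 and
  -- 4∑|Kᵢ| + 1.
  have hconst := is_const_of_deriv_eq_zero (fun y => (hd y).differentiableAt)
    (fun y => (hd y).deriv) 0 (4 * (∑ i, |K i|) + 1)
  have h1 := abs_le.mp (abs_expMean_one_zero_le K L hc (x, 0))
  have h2 := abs_le.mp (abs_expMean_one_zero_le K L hc (x, 4 * (∑ i, |K i|) + 1))
  simp only [hf] at hconst
  linarith

theorem dense_expMean_cross_ne (hc : ∀ i, 0 < c i) :
    Dense {p : ℝ × ℝ |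
      1 - 2 * (expMean c K L 1 1 p - expMean c K L 1 0 p * expMean c K L 0 1 p) ≠ 0} := by
  set g : ℝ × ℝ → ℝ := fun p =>
    1 - 2 * (expMean c K L 1 1 p - expMean c K L 1 0 p * expMean c K L 0 1 p) with hg
  intro p
  rw [mem_closure_iff_nhds]
  intro W hW
  by_contra hne
  have hzero : ∀ᶠ y in nhds p.2, g (p.1, y) = 0 := by
    have hcont : Filter.Tendsto (fun y => (p.1, y)) (nhds p.2) (nhds p) :=
      (Continuous.prodMk_right p.1).tendsto p.2
    filter_upwards [hcont hW] with y hy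
    by_contra hgy
    exact hne ⟨_, hy, hgy⟩
  have han : AnalyticOnNhd ℝ (fun y => g (p.1, y)) Set.univ := fun y _ => by
    have h := fun a b => analyticAt_expMean_snd K L hc a b p.1 y
    exact analyticAt_const.sub (analyticAt_const.mul ((h 1 1).sub ((h 1 0).mul (h 0 1))))
  have hall := han.eqOn_zero_of_preconnected_of_eventuallyEq_zero isPreconnected_univ
    (Set.mem_univ p.2) hzero
  obtain ⟨y, hy⟩ := exists_expMean_cross_ne K L hc p.1
  exact hy (hall (Set.mem_univ y))

/-- Terms with K > 0 decay and those with K = 0 drop out of the numerator, while the term `i₀` keeps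
the denominator away from zero. -/
theorem tendsto_expMean_one_zero_atBot (hc : ∀ i, 0 < c i) (hK : ∀ i, 0 ≤ K i) {i₀ : ι}
    (h₀ : K i₀ = 0) (y : ℝ) :
    Filter.Tendsto (fun s => expMean c K L 1 0 (s, y)) Filter.atBot (nhds 0) := by
  have hnum : Filter.Tendsto (fun s => ∑ i, K i ^ 1 * L i ^ 0 * expTerm c K L (s, y) i)
      Filter.atBot (nhds (∑ i : ι, 0)) := by
    refine tendsto_finsetSum _ fun i _ => ?_
    rcases (hK i).eq_or_lt with h | h
    · simp [← h]
    · have h1 : Filter.Tendsto (fun s => K i * s + L i * y) Filter.atBot Filter.atBot :=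
        Filter.tendsto_atBot_add_const_right _ _ (Filter.tendsto_id.const_mul_atBot h)
      have h2 := ((Real.tendsto_exp_atBot.comp h1).const_mul (c i)).const_mul (K i ^ 1 * L i ^ 0)
      rw [mul_zero, mul_zero] at h2
      exact h2
  rw [sum_const_zero] at hnum
  have hden : ∀ s, expTerm c K L (0, y) i₀ ≤ ∑ i, expTerm c K L (s, y) i := fun s => by
    have h1 : expTerm c K L (0, y) i₀ = expTerm c K L (s, y) i₀ := by simp [expTerm, h₀]
    rw [h1]
    exact single_le_sum (fun j _ => (expTerm_pos K L hc _ j).le) (mem_univ i₀)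
  have hpos := expTerm_pos K L hc (0, y) i₀
  have hnn : ∀ s, 0 ≤ ∑ i, K i ^ 1 * L i ^ 0 * expTerm c K L (s, y) i := fun s =>
    sum_nonneg fun i _ => by
      have := hK i
      have := (expTerm_pos K L hc (s, y) i).le
      simp only [pow_one, pow_zero, mul_one]
      positivity
  refine squeeze_zero (fun s => div_nonneg (hnn s) (sum_expTerm_pos K L hc _).le)
    (fun s => div_le_div_of_nonneg_left (hnn s) hpos (hden s)) ?_
  simpa using hnum.div_const (expTerm c K L (0, y) i₀)

theorem integrableOn_expMean_variance (hc : ∀ i, 0 < c i) (hK : ∀ i, 0 ≤ K i) {i₀ : ι}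
    (h₀ : K i₀ = 0) (p : ℝ × ℝ) :
    MeasureTheory.IntegrableOn (fun s => -2 * (expMean c K L 2 0 (s, p.2) -
        expMean c K L 1 0 (s, p.2) ^ 2)) (Set.Iic p.1) ∧
      ∫ s in Set.Iic p.1, -2 * (expMean c K L 2 0 (s, p.2) - expMean c K L 1 0 (s, p.2) ^ 2) =
        -2 * expMean c K L 1 0 p := by
  have hd : ∀ s, HasDerivAt (fun s => -2 * expMean c K L 1 0 (s, p.2))
      (-2 * (expMean c K L 2 0 (s, p.2) - expMean c K L 1 0 (s, p.2) ^ 2)) s := fun s => by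
    rw [sq]
    exact (hasDerivAt_expMean_fst K L hc 1 0 (s, p.2)).const_mul (-2)
  have hlim : Filter.Tendsto (fun s => -2 * expMean c K L 1 0 (s, p.2)) Filter.atBot (nhds 0) := by
    simpa using (tendsto_expMean_one_zero_atBot K L hc hK h₀ p.2).const_mul (-2)
  have hcont : ContinuousWithinAt (fun s => -2 * expMean c K L 1 0 (s, p.2)) (Set.Iic p.1) p.1 :=
    (hd p.1).continuousAt.continuousWithinAt
  have hint := integrableOn_Iic_deriv_of_nonpos hd
    (fun s => by nlinarith [sq_expMean_one_zero_le K L hc (s, p.2)]) hlim p.1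
  refine ⟨hint, ?_⟩
  rw [MeasureTheory.integral_Iic_of_hasDerivAt_of_tendsto hcont (fun s _ => hd s) hint hlim,
    sub_zero]

end Moments

end ReducedOstrovsky

/-! ### Transfer of the equation through the hodograph transformation. -/

namespace ReducedOstrovsky

open Topology

theorem _root_.HasFDerivAt.hasDerivAt_fst {F : ℝ × ℝ → ℝ} {F' : ℝ × ℝ →L[ℝ] ℝ} {p : ℝ × ℝ}
    (h : HasFDerivAt F F' p) : HasDerivAt (fun s => F (s, p.2)) (F' (1, 0)) p.1 :=
  HasFDerivAt.comp_hasDerivAt (f := fun s : ℝ => (s, p.2)) p.1 h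
    ((hasDerivAt_id p.1).prodMk (hasDerivAt_const p.1 p.2))

theorem _root_.HasFDerivAt.hasDerivAt_snd {F : ℝ × ℝ → ℝ} {F' : ℝ × ℝ →L[ℝ] ℝ} {p : ℝ × ℝ}
    (h : HasFDerivAt F F' p) : HasDerivAt (fun s => F (p.1, s)) (F' (0, 1)) p.2 :=
  HasFDerivAt.comp_hasDerivAt (f := fun s : ℝ => (p.1, s)) p.2 h
    ((hasDerivAt_const p.2 p.1).prodMk (hasDerivAt_id p.2))

theorem apply_eq_fst_mul_add_snd_mul (F' : ℝ × ℝ →L[ℝ] ℝ) (a b : ℝ) :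
    F' (a, b) = a * F' (1, 0) + b * F' (0, 1) := by
  have h : ((a, b) : ℝ × ℝ) = a • (1, 0) + b • (0, 1) := by simp
  rw [h, map_add, map_smul, map_smul, smul_eq_mul, smul_eq_mul]

/-- The derivative `(a, b) ↦ (u a + J b, a)` of the hodograph transformation. -/
noncomputable def hodographDeriv (u J : ℝ) (hJ : J ≠ 0) : (ℝ × ℝ) ≃L[ℝ] (ℝ × ℝ) :=
  ContinuousLinearEquiv.equivOfInverse
    ((u • ContinuousLinearMap.fst ℝ ℝ ℝ + J • ContinuousLinearMap.snd ℝ ℝ ℝ).prod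
      (ContinuousLinearMap.fst ℝ ℝ ℝ))
    ((ContinuousLinearMap.snd ℝ ℝ ℝ).prod
      (J⁻¹ • (ContinuousLinearMap.fst ℝ ℝ ℝ - u • ContinuousLinearMap.snd ℝ ℝ ℝ)))
    (fun p => by ext <;> simp; field_simp)
    (fun p => by ext <;> simp; field_simp; ring)

section Hodograph

variable {X u v J : ℝ × ℝ → ℝ}

theorem hasFDerivAt_hodograph (hX : ContDiff ℝ ∞ X)
    (hXs : ∀ p, HasDerivAt (fun s => X (s, p.2)) (u p) p.1)
    (hXy : ∀ p, HasDerivAt (fun s => X (p.1, s)) (J p) p.2) (p : ℝ × ℝ) (hJ : J p ≠ 0) :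
    HasFDerivAt (fun q : ℝ × ℝ => (X q, q.1))
      (hodographDeriv (u p) (J p) hJ : ℝ × ℝ →L[ℝ] ℝ × ℝ) p := by
  have h1 := (hX.differentiable (by simp) p).hasFDerivAt
  refine (h1.prodMk hasFDerivAt_fst).congr_fderiv ?_
  refine ContinuousLinearMap.ext fun ⟨a, b⟩ => ?_
  have h2 := apply_eq_fst_mul_add_snd_mul (fderiv ℝ X p) a b
  rw [h1.hasDerivAt_fst.unique (hXs p), h1.hasDerivAt_snd.unique (hXy p)] at h2
  simp [hodographDeriv, h2, mul_comm]

theorem contDiff_hodograph (hX : ContDiff ℝ ∞ X) :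
    ContDiff ℝ ∞ fun q : ℝ × ℝ => (X q, q.1) := hX.prodMk contDiff_fst

theorem exists_injOn_hodograph (hX : ContDiff ℝ ∞ X)
    (hXs : ∀ p, HasDerivAt (fun s => X (s, p.2)) (u p) p.1)
    (hXy : ∀ p, HasDerivAt (fun s => X (p.1, s)) (J p) p.2) (hJ : Continuous J) (p : ℝ × ℝ)
    (hJp : J p ≠ 0) :
    ∃ V : Set (ℝ × ℝ), IsOpen V ∧ p ∈ V ∧ V ⊆ {q | J q ≠ 0} ∧
      Set.InjOn (fun q : ℝ × ℝ => (X q, q.1)) V := by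
  let e := (contDiff_hodograph hX).contDiffAt.toOpenPartialHomeomorph _
    (hasFDerivAt_hodograph hX hXs hXy p hJp) (by simp)
  refine ⟨e.source ∩ {q | J q ≠ 0}, e.open_source.inter (isOpen_ne_fun hJ continuous_const),
    ⟨ContDiffAt.mem_toOpenPartialHomeomorph_source _ _ _, hJp⟩, Set.inter_subset_right, ?_⟩
  exact e.injOn.mono Set.inter_subset_left

/-- A local inverse of the hodograph transformation at a regular point. -/
theorem exists_localInverse_hodograph (hX : ContDiff ℝ ∞ X)
    (hXs : ∀ p, HasDerivAt (fun s => X (s, p.2)) (u p) p.1)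
    (hXy : ∀ p, HasDerivAt (fun s => X (p.1, s)) (J p) p.2) {V : Set (ℝ × ℝ)} (hV : IsOpen V)
    {p : ℝ × ℝ} (hp : p ∈ V) (hJp : J p ≠ 0) :
    ∃ g : ℝ × ℝ → ℝ × ℝ, ContDiffAt ℝ ∞ g (X p, p.1) ∧ g (X p, p.1) = p ∧
      ∀ᶠ q in 𝓝 (X p, p.1), g q ∈ V ∧ (X (g q), (g q).1) = q := by
  have hcd := (contDiff_hodograph hX).contDiffAt (x := p)
  have hfd := hasFDerivAt_hodograph hX hXs hXy p hJp
  have hn : (∞ : WithTop ℕ∞) ≠ 0 := by simp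
  have hg := hcd.to_localInverse hfd hn
  have hgp := hcd.localInverse_apply_image hfd hn
  refine ⟨hcd.localInverse hfd hn, hg, hgp, ?_⟩
  have hcont := hg.continuousAt
  rw [ContinuousAt, hgp] at hcont
  exact (hcont.eventually_mem (hV.mem_nhds hp)).and (hcd.hasStrictFDerivAt' hfd hn).eventually_right_inverse

theorem eventuallyEq_comp_localInverse {X F G : ℝ × ℝ → ℝ} {V : Set (ℝ × ℝ)}
    {g : ℝ × ℝ → ℝ × ℝ} {q : ℝ × ℝ} (hG : ∀ p ∈ V, G (X p, p.1) = F p)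
    (hg : ∀ᶠ q in 𝓝 q, g q ∈ V ∧ (X (g q), (g q).1) = q) : G =ᶠ[𝓝 q] F ∘ g := by
  filter_upwards [hg] with r hr
  rw [Function.comp_apply, ← hG _ hr.1, hr.2]

theorem contDiffAt_of_comp_hodograph (hX : ContDiff ℝ ∞ X)
    (hXs : ∀ p, HasDerivAt (fun s => X (s, p.2)) (u p) p.1)
    (hXy : ∀ p, HasDerivAt (fun s => X (p.1, s)) (J p) p.2) {V : Set (ℝ × ℝ)} (hV : IsOpen V)
    {F G : ℝ × ℝ → ℝ} (hF : ContDiff ℝ ∞ F) (hG : ∀ p ∈ V, G (X p, p.1) = F p)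
    {p : ℝ × ℝ} (hp : p ∈ V) (hJp : J p ≠ 0) : ContDiffAt ℝ ∞ G (X p, p.1) := by
  obtain ⟨g, hg, -, hev⟩ := exists_localInverse_hodograph hX hXs hXy hV hp hJp
  exact (hF.contDiffAt.comp _ hg).congr_of_eventuallyEq (eventuallyEq_comp_localInverse hG hev)

theorem isSolutionOn_of_hodograph (hX : ContDiff ℝ ∞ X) (hu : ContDiff ℝ ∞ u)
    (hv : ContDiff ℝ ∞ v)
    (hXs : ∀ p, HasDerivAt (fun s => X (s, p.2)) (u p) p.1)
    (hXy : ∀ p, HasDerivAt (fun s => X (p.1, s)) (J p) p.2)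
    (hus : ∀ p, HasDerivAt (fun s => u (s, p.2)) (v p) p.1)
    (hvy : ∀ p, HasDerivAt (fun s => v (p.1, s)) (3 * u p * J p) p.2)
    {V : Set (ℝ × ℝ)} (hV : IsOpen V) (hVJ : ∀ p ∈ V, J p ≠ 0) {U : ℝ × ℝ → ℝ}
    (hU : ∀ p ∈ V, U (X p, p.1) = u p) :
    IsSolutionOn U ((fun p : ℝ × ℝ => (X p, p.1)) '' V) := by
  have hUcd : ∀ p ∈ V, ContDiffAt ℝ ∞ U (X p, p.1) := fun p hp =>
    contDiffAt_of_comp_hodograph hX hXs hXy hV hu hU hp (hVJ p hp)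
  set W : ℝ × ℝ → ℝ := fun r => pderivSnd U r + U r * pderivFst U r with hWdef
  -- Along x₁ the image curve has velocity (u, 1), so the chain rule makes `W` the material
  -- derivative of `U`, equal to `v`. Along x₋₁ the velocity is (J, 0), which later gives J·Wₓ =
  -- 3uJ, and J cancels.
  have hW : ∀ p ∈ V, W (X p, p.1) = v p := by
    intro p hp
    have hd := ((hUcd p hp).differentiableAt (by simp)).hasFDerivAt
    have h1 : HasDerivAt (fun s => U (X (s, p.2), s)) (fderiv ℝ U (X p, p.1) (u p, 1)) p.1 :=
      HasFDerivAt.comp_hasDerivAt (f := fun s : ℝ => (X (s, p.2), s)) p.1 hd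
        ((hXs p).prodMk (hasDerivAt_id p.1))
    have h2 : (fun s => U (X (s, p.2), s)) =ᶠ[𝓝 p.1] fun s => u (s, p.2) := by
      have hcont : Filter.Tendsto (fun s => (s, p.2)) (𝓝 p.1) (𝓝 p) :=
        (Continuous.prodMk_left p.2).tendsto p.1
      filter_upwards [hcont (hV.mem_nhds hp)] with s hs using hU _ hs
    have h3 := h1.unique ((hus p).congr_of_eventuallyEq h2)
    rw [apply_eq_fst_mul_add_snd_mul] at h3
    simp only [hWdef, pderivSnd, pderivFst, hd.hasDerivAt_fst.deriv, hd.hasDerivAt_snd.deriv, hU p hp]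
    linarith
  refine ⟨?_, ?_, ?_⟩
  · rw [isOpen_iff_mem_nhds]
    rintro _ ⟨p, hp, rfl⟩
    obtain ⟨g, -, -, hev⟩ := exists_localInverse_hodograph hX hXs hXy hV hp (hVJ p hp)
    filter_upwards [hev] with q hq using ⟨g q, hq⟩
  · rintro _ ⟨p, hp, rfl⟩
    exact (hUcd p hp).contDiffWithinAt
  · rintro _ ⟨p, hp, rfl⟩
    beta_reduce
    have hd := ((contDiffAt_of_comp_hodograph hX hXs hXy hV hv hW hp
      (hVJ p hp)).differentiableAt (by simp)).hasFDerivAt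
    have h1 : HasDerivAt (fun s => W (X (p.1, s), p.1)) (fderiv ℝ W (X p, p.1) (J p, 0)) p.2 :=
      HasFDerivAt.comp_hasDerivAt (f := fun s : ℝ => (X (p.1, s), p.1)) p.2 hd
        ((hXy p).prodMk (hasDerivAt_const p.2 p.1))
    have h2 : (fun s => W (X (p.1, s), p.1)) =ᶠ[𝓝 p.2] fun s => v (p.1, s) := by
      have hcont : Filter.Tendsto (fun s => (p.1, s)) (𝓝 p.2) (𝓝 p) :=
        (Continuous.prodMk_right p.1).tendsto p.2
      filter_upwards [hcont (hV.mem_nhds hp)] with s hs using hW _ hs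
    have h3 := h1.unique ((hvy p).congr_of_eventuallyEq h2)
    rw [apply_eq_fst_mul_add_snd_mul, zero_mul, add_zero, mul_comm (3 * u p)] at h3
    rw [pderivFst, hd.hasDerivAt_fst.deriv, mul_left_cancel₀ (hVJ p hp) h3, hU p hp, sub_self]

end Hodograph

end ReducedOstrovsky

/-! ### Application to the soliton τ-function. -/

namespace ReducedOstrovsky

open Finset

section Soliton

variable {N : ℕ} (k η₀ : Fin N → ℝ)

/-- The weighted mean of `Kᵃ Lᵇ` over the terms of the `τ`-function with wave numbers `K`, `L`. -/
noncomputable def tauMean (a b : ℕ) (p : ℝ × ℝ) : ℝ :=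
  expMean (fun μ => Real.exp (logAmplitude k η₀ μ)) (freqFst k) (freqSnd k) a b p

theorem tauMean_fst (a b : ℕ) (p : ℝ × ℝ) :
    HasDerivAt (fun s => tauMean k η₀ a b (s, p.2))
      (tauMean k η₀ (a + 1) b p - tauMean k η₀ a b p * tauMean k η₀ 1 0 p) p.1 :=
  hasDerivAt_expMean_fst _ _ (fun _ => Real.exp_pos _) a b p

theorem tauMean_snd (a b : ℕ) (p : ℝ × ℝ) :
    HasDerivAt (fun s => tauMean k η₀ a b (p.1, s))
      (tauMean k η₀ a (b + 1) p - tauMean k η₀ a b p * tauMean k η₀ 0 1 p) p.2 :=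
  hasDerivAt_expMean_snd _ _ (fun _ => Real.exp_pos _) a b p

theorem contDiff_tauMean (a b : ℕ) : ContDiff ℝ ∞ (tauMean k η₀ a b) :=
  contDiff_expMean _ _ (fun _ => Real.exp_pos _) a b

theorem tau_pos (p : ℝ × ℝ) : 0 < tau k η₀ p :=
  sum_pos (fun _ _ => Real.exp_pos _) univ_nonempty

theorem hasDerivAt_log_tau (p : ℝ × ℝ) :
    HasDerivAt (fun s => Real.log (tau k η₀ (s, p.2))) (tauMean k η₀ 1 0 p) p.1 := by
  simp only [tau_eq]
  exact hasDerivAt_log_sum_expTerm_fst _ _ (fun _ => Real.exp_pos _) p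

theorem solitonU_eq : solitonU k η₀ =
    fun p => -2 * (tauMean k η₀ 2 0 p - tauMean k η₀ 1 0 p ^ 2) := by
  have h : pderivFst (fun q => Real.log (tau k η₀ q)) = tauMean k η₀ 1 0 :=
    funext fun p => (hasDerivAt_log_tau k η₀ p).deriv
  funext p
  rw [solitonU, h, pderivFst, (tauMean_fst k η₀ 1 0 p).deriv, sq]

theorem hodographX_eq : hodographX k η₀ = fun p => p.2 - 2 * tauMean k η₀ 1 0 p := by
  funext p
  have h : (fun q => Real.log (tau k η₀ q ^ 2)) = fun q => 2 * Real.log (tau k η₀ q) :=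
    funext fun q => by rw [Real.log_pow, Nat.cast_ofNat]
  rw [hodographX, h, pderivFst, ((hasDerivAt_log_tau k η₀ p).const_mul 2).deriv]

/-- The derivative `∂x/∂x₋₁` of the hodograph transformation. -/
noncomputable def hodographJacobian (p : ℝ × ℝ) : ℝ :=
  1 - 2 * (tauMean k η₀ 1 1 p - tauMean k η₀ 1 0 p * tauMean k η₀ 0 1 p)

/-- The derivative `∂u/∂x₁`. -/
noncomputable def solitonUDeriv (p : ℝ × ℝ) : ℝ :=
  -2 * (tauMean k η₀ 3 0 p - 3 * tauMean k η₀ 2 0 p * tauMean k η₀ 1 0 p +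
    2 * tauMean k η₀ 1 0 p ^ 3)

theorem hasDerivAt_hodographX_fst (p : ℝ × ℝ) :
    HasDerivAt (fun s => hodographX k η₀ (s, p.2)) (solitonU k η₀ p) p.1 := by
  rw [hodographX_eq, solitonU_eq]
  refine (((tauMean_fst k η₀ 1 0 p).const_mul 2).const_sub p.2).congr_deriv ?_
  ring

theorem hasDerivAt_hodographX_snd (p : ℝ × ℝ) :
    HasDerivAt (fun s => hodographX k η₀ (p.1, s)) (hodographJacobian k η₀ p) p.2 := by
  rw [hodographX_eq]
  exact (hasDerivAt_id p.2).sub ((tauMean_snd k η₀ 1 0 p).const_mul 2)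

theorem regularSet_eq : regularSet k η₀ = {p | hodographJacobian k η₀ p ≠ 0} := by
  ext p
  rw [regularSet, Set.mem_ofPred_eq, pderivSnd, (hasDerivAt_hodographX_snd k η₀ p).deriv]
  rfl

theorem hasDerivAt_solitonU_fst (p : ℝ × ℝ) :
    HasDerivAt (fun s => solitonU k η₀ (s, p.2)) (solitonUDeriv k η₀ p) p.1 := by
  rw [solitonU_eq]
  refine (((tauMean_fst k η₀ 2 0 p).sub ((tauMean_fst k η₀ 1 0 p).pow 2)).const_mul
    (-2)).congr_deriv ?_
  simp only [solitonUDeriv, Prod.mk.eta]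
  ring

-- This is half the bilinear equation divided by τ²: terms related by exchanging the two factors
-- coincide.
variable {k} in
theorem bilinear_tauMean (hk : ∀ i, k i ≠ 0) (hkk : ∀ i j, i ≠ j → k i ≠ k j ∧ k i ≠ -k j)
    (p : ℝ × ℝ) :
    tauMean k η₀ 3 1 p - tauMean k η₀ 3 0 p * tauMean k η₀ 0 1 p -
      3 * tauMean k η₀ 2 1 p * tauMean k η₀ 1 0 p +
      3 * tauMean k η₀ 2 0 p * tauMean k η₀ 1 1 p =
      3 * (tauMean k η₀ 2 0 p - tauMean k η₀ 1 0 p ^ 2) := by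
  set M : ℕ → ℕ → ℝ := fun a b => ∑ μ, freqFst k μ ^ a * freqSnd k μ ^ b * tauTerm k η₀ p μ with hM
  have hM0 : M 0 0 ≠ 0 := by
    simp only [hM, pow_zero, one_mul, ← tau_eq]
    exact (tau_pos k η₀ p).ne'
  have hm : ∀ a b, tauMean k η₀ a b p = M a b / M 0 0 := fun a b => by
    simp only [hM, pow_zero, one_mul]
    rfl
  have h := sum_bilinearTerm hk hkk η₀ p
  rw [Fintype.sum_prod_type] at h
  have h1 : M 3 1 * M 0 0 - M 3 0 * M 0 1 - 3 * (M 2 1 * M 1 0) + 3 * (M 2 0 * M 1 1) +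
      3 * (M 1 1 * M 2 0) - 3 * (M 1 0 * M 2 1) - M 0 1 * M 3 0 + M 0 0 * M 3 1 -
      3 * (M 2 0 * M 0 0) + 6 * (M 1 0 * M 1 0) - 3 * (M 0 0 * M 2 0) = 0 := by
    rw [← h]
    simp only [hM, sum_mul_sum]
    simp only [mul_sum, ← sum_sub_distrib, ← sum_add_distrib]
    refine sum_congr rfl fun μ _ => sum_congr rfl fun ν _ => ?_
    rw [bilinearTerm]
    ring
  simp only [hm]
  field_simp
  linarith

-- `solitonUDeriv` is -2 times the third cumulant of K. Its x₋₁-derivative is -2 times the mixed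
-- fourth cumulant, which by `bilinear_tauMean` equals 3·Var(K)·(1 - 2·Cov(K, L)); here u =
-- -2·Var(K) and J = 1 - 2·Cov(K, L).
variable {k} in
theorem hasDerivAt_solitonUDeriv_snd (hk : ∀ i, k i ≠ 0)
    (hkk : ∀ i j, i ≠ j → k i ≠ k j ∧ k i ≠ -k j) (p : ℝ × ℝ) :
    HasDerivAt (fun s => solitonUDeriv k η₀ (p.1, s))
      (3 * solitonU k η₀ p * hodographJacobian k η₀ p) p.2 := by
  have h1 := tauMean_snd k η₀ 1 0 p
  refine ((((tauMean_snd k η₀ 3 0 p).sub (((tauMean_snd k η₀ 2 0 p).const_mul 3).mul h1)).add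
    ((h1.pow 3).const_mul 2)).const_mul (-2)).congr_deriv ?_
  rw [solitonU_eq]
  simp only [hodographJacobian, Prod.mk.eta]
  linear_combination -2 * bilinear_tauMean η₀ hk hkk p

theorem contDiff_hodographX : ContDiff ℝ ∞ (hodographX k η₀) := by
  rw [hodographX_eq]
  exact contDiff_snd.sub (contDiff_const.mul (contDiff_tauMean k η₀ 1 0))

theorem contDiff_solitonU : ContDiff ℝ ∞ (solitonU k η₀) := by
  rw [solitonU_eq]
  exact contDiff_const.mul ((contDiff_tauMean k η₀ 2 0).sub ((contDiff_tauMean k η₀ 1 0).pow 2))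

theorem contDiff_solitonUDeriv : ContDiff ℝ ∞ (solitonUDeriv k η₀) := by
  have h1 := contDiff_tauMean k η₀ 1 0
  exact contDiff_const.mul (((contDiff_tauMean k η₀ 3 0).sub
    ((contDiff_const.mul (contDiff_tauMean k η₀ 2 0)).mul h1)).add (contDiff_const.mul (h1.pow 3)))

theorem continuous_hodographJacobian : Continuous (hodographJacobian k η₀) := by
  have h := fun a b => (contDiff_tauMean k η₀ a b).continuous
  exact continuous_const.sub (continuous_const.mul ((h 1 1).sub ((h 1 0).mul (h 0 1))))

theorem dense_regularSet : Dense (regularSet k η₀) := by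
  rw [regularSet_eq]
  exact dense_expMean_cross_ne _ _ fun _ => Real.exp_pos _

variable {k} in
theorem hodographX_eq_integral (hk : ∀ i, 0 < k i) (p : ℝ × ℝ) :
    MeasureTheory.IntegrableOn (fun s => solitonU k η₀ (s, p.2)) (Set.Iic p.1) ∧
      hodographX k η₀ p = p.2 + ∫ s in Set.Iic p.1, solitonU k η₀ (s, p.2) := by
  have h := integrableOn_expMean_variance (c := fun μ => Real.exp (logAmplitude k η₀ μ))
    (freqFst k) (freqSnd k) (fun _ => Real.exp_pos _)
    (fun μ => sum_nonneg fun i _ => mul_nonneg (Nat.cast_nonneg _) (hk i).le)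
    -- The zero multi-index is the constant term of τ, with wave number 0.
    (i₀ := 0) (by simp [freqFst]) p
  rw [solitonU_eq, hodographX_eq]
  refine ⟨h.1, ?_⟩
  refine Eq.trans ?_ (congrArg (p.2 + ·) h.2.symm)
  simp only [tauMean]
  ring

end Soliton

end ReducedOstrovsky

theorem mainTheorem2 (N : ℕ) (k η₀ : Fin N → ℝ)
    (hk : ∀ i, k i ≠ 0)
    (hkk : ∀ i j, i ≠ j → k i ≠ k j ∧ k i ≠ -k j) :
    -- the two expressions for `x` agree when all wave numbers are positive
    ((∀ i, 0 < k i) → ∀ p : ℝ × ℝ,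
      MeasureTheory.IntegrableOn
        (fun s => ReducedOstrovsky.solitonU k η₀ (s, p.2)) (Set.Iic p.1) ∧
      ReducedOstrovsky.hodographX k η₀ p =
        p.2 + ∫ s in Set.Iic p.1, ReducedOstrovsky.solitonU k η₀ (s, p.2)) ∧
    -- the regular points are dense, and near each of them the transformation is injective
    Dense (ReducedOstrovsky.regularSet k η₀) ∧
    (∀ p ∈ ReducedOstrovsky.regularSet k η₀, ∃ V : Set (ℝ × ℝ),
      IsOpen V ∧ p ∈ V ∧ V ⊆ ReducedOstrovsky.regularSet k η₀ ∧
      Set.InjOn (ReducedOstrovsky.hodograph k η₀) V) ∧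
    -- on each single-valued regular branch, `u` as a function of `(x, t)` is a solution
    (∀ V : Set (ℝ × ℝ), IsOpen V → V ⊆ ReducedOstrovsky.regularSet k η₀ →
      Set.InjOn (ReducedOstrovsky.hodograph k η₀) V →
      ∀ U : ℝ × ℝ → ℝ,
        (∀ p ∈ V, U (ReducedOstrovsky.hodograph k η₀ p) = ReducedOstrovsky.solitonU k η₀ p) →
        ReducedOstrovsky.IsSolutionOn U (ReducedOstrovsky.hodograph k η₀ '' V)) := by
  refine ⟨fun hpos p => ReducedOstrovsky.hodographX_eq_integral η₀ hpos p,
    ReducedOstrovsky.dense_regularSet k η₀, fun p hp => ?_, fun V hV hVR _ U hU => ?_⟩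
  · rw [ReducedOstrovsky.regularSet_eq] at hp ⊢
    exact ReducedOstrovsky.exists_injOn_hodograph (ReducedOstrovsky.contDiff_hodographX k η₀)
      (ReducedOstrovsky.hasDerivAt_hodographX_fst k η₀)
      (ReducedOstrovsky.hasDerivAt_hodographX_snd k η₀)
      (ReducedOstrovsky.continuous_hodographJacobian k η₀) p hp
  · rw [ReducedOstrovsky.regularSet_eq] at hVR
    exact ReducedOstrovsky.isSolutionOn_of_hodograph (ReducedOstrovsky.contDiff_hodographX k η₀)
      (ReducedOstrovsky.contDiff_solitonU k η₀) (ReducedOstrovsky.contDiff_solitonUDeriv k η₀)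
      (ReducedOstrovsky.hasDerivAt_hodographX_fst k η₀)
      (ReducedOstrovsky.hasDerivAt_hodographX_snd k η₀)
      (ReducedOstrovsky.hasDerivAt_solitonU_fst k η₀)
      (ReducedOstrovsky.hasDerivAt_solitonUDeriv_snd η₀ hk hkk) hV (fun p hp => hVR hp) hU
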